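/- Assume that every finite Borel measure $\mu$ on a metric space is $\tau$-additive, i.e. $\mu(\bigcup_j U_j)=\sup_j\mu(U_j)$ for every upward directed family of open sets $U_j$. **Language.** A metric-measure language $L$ has a binary symbol $\rho$ for the metric, a symbol $\mu$ for the measure, and sets of constant symbols, function symbols $F$ (arity $n_F\ge 1$, modulus $\Delta_F:\mathbb R^+\to\mathbb R^+$) and relation symbols $R$ (arity $n_R\ge1$, bound $b_R\ge 0$, modulus $\Delta_R:\mathbb R^+\to\mathbb R^+$). Terms are built as usual; formulas are built from $1$, $\rho(t_1,t_2)$ and $R(t_1,\dots,t_{n_R})$ by $r\phi$ ($r\in\mathbb R$), $\phi+\psi$, $\phi\wedge\psi$, $\sup_x\phi$ and $\int\phi\,dx$. Sentences are formulas without free variables; closed statements are the expressions $\phi=\psi$ and $\phi\le\psi$ with $\phi,\psi$ sentences. **Structures.** A (metric-measure) $L$-structure is a nonempty metric space $(M,\rho)$ of diameter at most $1$ with a Borel measure $\mu$ such that $\mu(M)\le 1$, an element $c^M$ for each constant symbol, and maps $F^M:M^{n_F}\to M$, $R^M:M^{n_R}\to[-b_R,b_R]$ that are uniformly continuous with the given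 moduli, where powers carry the maximum metric and $f$ has modulus $\Delta$ if $d(x,y)<\Delta(\epsilon)$ implies $d(f(x),f(y))\le\epsilon$ for all $\epsilon>0$. Formulas are evaluated in $\mathbb R$ in the obvious way, with $\wedge$ as minimum, $\sup_x$ as supremum over $M$ and $\int\cdot\,dx$ as the integral with respect to $\mu$. Two $L$-structures are elementarily equivalent if every sentence has the same value in both. **Ultraproducts.** Let $\mathcal D$ be an ultrafilter on a set $I$ and $(M_i)_{i\in I}$ a family of $L$-structures. Let $M$ be the set of classes $[a_i]$ of families modulo equality on a set in $\mathcal D$, with the pseudometric $\rho([a_i],[b_i])=\lim_{\mathcal D}\rho_i(a_i,b_i)$, and let $\pi:M\to\hat M$ be the quotient map identifying points at distance $0$. $\hat M$ is a metric space in which the symbols are interpreted by $c=\pi[c^{M_i}]$, $F(\pi[a_i^1],\dots)=\pi[F^{M_i}(a_i^1,\dots)]$ and $R(\pi[a_i^1],\dots)=\lim_{\mathcal D}R^{M_i}(a_i^1,\dots)$. For Borel sets $A_i\subseteq M_i$ put $[A_i]=\{[a_i]:\{i:a_i\in A_i\}\in\mathcal D\}$, and let $\mu$ be the Carathéodory extension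 of $[A_i]\mapsto\lim_{\mathcal D}\mu_i(A_i)$ to the $\sigma$-algebra generated by these sets. If there is a Borel measure $\hat\mu$ on $\hat M$ with $\hat\mu(B)=\mu(\pi^{-1}(B))$ for all $B$ in the $\sigma$-algebra generated by the open balls of $\hat M$ (it is then unique), the $L$-structure $\hat M$ with the measure $\hat\mu$ is called the ultraproduct of the $M_i$ with respect to $\mathcal D$, and we say that the ultraproduct exists. **Proposition 4.8 (Axiomatizability).** Let $\mathcal K$ be a class of metric-measure $L$-structures. Then $\mathcal K$ is an elementary class, i.e. the class of all models of some set of closed statements, if and only if 1. every $L$-structure that is elementarily equivalent to a member of $\mathcal K$ is in $\mathcal K$, and 2. whenever all $M_i$ are in $\mathcal K$ and the ultraproduct of $(M_i)_{i\in I}$ with respect to an ultrafilter on $I$ exists, it is in $\mathcal K$. -/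

import Mathlib

open Filter Topology MeasureTheory Set

universe u

namespace ContIntLogic

noncomputable section

/-! ### Languages -/

/-- A metric-measure language.  The distinguished binary symbol `ρ` for the metric and the measure
symbol `μ` are built into the logic (see `Formula.rho` and `Formula.integral`), so only the further
constant, function and relation symbols are listed, with their arities (at least `1`), bounds of
relation symbols and moduli of uniform continuity `ℝ⁺ → ℝ⁺` (whose values outside of `ℝ⁺` are
irrelevant). -/
structure MMLanguage where
  Const : Type u
  Fn : Type u
  Rel : Type u
  fnArity : Fn → ℕ
  relArity : Rel → ℕ
  one_le_fnArity : ∀ F, 1 ≤ fnArity F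
  one_le_relArity : ∀ R, 1 ≤ relArity R
  relBound : Rel → ℝ
  relBound_nonneg : ∀ R, 0 ≤ relBound R
  fnModulus : Fn → ℝ → ℝ
  fnModulus_pos : ∀ F ε, 0 < ε → 0 < fnModulus F ε
  relModulus : Rel → ℝ → ℝ
  relModulus_pos : ∀ R ε, 0 < ε → 0 < relModulus R ε

/-- `f` is uniformly continuous with modulus `Δ : ℝ⁺ → ℝ⁺`. -/
def UniformlyContinuousWithModulus {X Y : Type*} [PseudoMetricSpace X] [PseudoMetricSpace Y]
    (Δ : ℝ → ℝ) (f : X → Y) : Prop :=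
  ∀ ε, 0 < ε → ∀ x y, dist x y < Δ ε → dist (f x) (f y) ≤ ε

/-- Terms whose variables are among `x₀, …, xₙ₋₁`. -/
inductive Term (L : MMLanguage.{u}) (n : ℕ) : Type u
  | var : Fin n → Term L n
  | const : L.Const → Term L n
  | app : (F : L.Fn) → (Fin (L.fnArity F) → Term L n) → Term L n

/-- Formulas whose free variables are among `x₀, …, xₙ₋₁`.  The quantifiers `sup` and `integral`
bind the last variable. -/
inductive Formula (L : MMLanguage.{u}) : ℕ → Type u
  | one {n : ℕ} : Formula L n
  | rho {n : ℕ} : Term L n → Term L n → Formula L n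
  | rel {n : ℕ} : (R : L.Rel) → (Fin (L.relArity R) → Term L n) → Formula L n
  | smul {n : ℕ} : ℝ → Formula L n → Formula L n
  | add {n : ℕ} : Formula L n → Formula L n → Formula L n
  | inf {n : ℕ} : Formula L n → Formula L n → Formula L n
  | sup {n : ℕ} : Formula L (n + 1) → Formula L n
  | integral {n : ℕ} : Formula L (n + 1) → Formula L n

/-- Sentences are formulas without free variables. -/
abbrev Sentence (L : MMLanguage.{u}) : Type u := Formula L 0

/-! ### Structures -/

/-- A metric `L`-structure: a nonempty metric space of diameter at most `1` with interpretations of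
the symbols obeying the bounds and moduli of the language.  The powers `Fin n → M` carry the
maximum metric. -/
structure MetricStructure (L : MMLanguage.{u}) where
  carrier : Type u
  metric : MetricSpace carrier
  nonempty : Nonempty carrier
  dist_le_one : ∀ x y : carrier, dist x y ≤ 1
  const : L.Const → carrier
  fn : ∀ F : L.Fn, (Fin (L.fnArity F) → carrier) → carrier
  rel : ∀ R : L.Rel, (Fin (L.relArity R) → carrier) → ℝ
  rel_bound : ∀ R x, |rel R x| ≤ L.relBound R
  fn_modulus : ∀ F, UniformlyContinuousWithModulus (L.fnModulus F) (fn F)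
  rel_modulus : ∀ R, UniformlyContinuousWithModulus (L.relModulus R) (rel R)

instance {L : MMLanguage.{u}} (M : MetricStructure L) : MetricSpace M.carrier := M.metric

instance {L : MMLanguage.{u}} (M : MetricStructure L) : Nonempty M.carrier := M.nonempty

/-- Structures always carry their Borel `σ`-algebra. -/
instance {L : MMLanguage.{u}} (M : MetricStructure L) : MeasurableSpace M.carrier :=
  borel M.carrier

instance {L : MMLanguage.{u}} (M : MetricStructure L) : BorelSpace M.carrier := ⟨rfl⟩

/-- A metric-measure `L`-structure: a metric `L`-structure with a Borel measure of total mass at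
most `1`. -/
structure MMStructure (L : MMLanguage.{u}) extends MetricStructure L where
  measure : @Measure carrier
    (@borel carrier metric.toPseudoMetricSpace.toUniformSpace.toTopologicalSpace)
  measure_univ_le : measure univ ≤ 1

/-- Interpretation of terms. -/
def Term.eval {L : MMLanguage.{u}} (M : MetricStructure L) {n : ℕ} :
    Term L n → (Fin n → M.carrier) → M.carrier
  | .var i, a => a i
  | .const c, _ => M.const c
  | .app F t, a => M.fn F fun k => (t k).eval M a

/-- Interpretation of formulas; `Fin.snoc a b` is the tuple `(a, b)`. -/
def Formula.eval {L : MMLanguage.{u}} (M : MMStructure L) :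
    {n : ℕ} → Formula L n → (Fin n → M.carrier) → ℝ
  | _, .one, _ => 1
  | _, .rho s t, a => dist (s.eval M.toMetricStructure a) (t.eval M.toMetricStructure a)
  | _, .rel R t, a => M.rel R fun k => (t k).eval M.toMetricStructure a
  | _, .smul r φ, a => r * φ.eval M a
  | _, .add φ ψ, a => φ.eval M a + ψ.eval M a
  | _, .inf φ ψ, a => min (φ.eval M a) (ψ.eval M a)
  | _, .sup φ, a => ⨆ b : M.carrier, φ.eval M (Fin.snoc (α := fun _ => M.carrier) a b)
  | _, .integral φ, a =>
      ∫ b : M.carrier, φ.eval M (Fin.snoc (α := fun _ => M.carrier) a b) ∂M.measure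

/-- The value of a sentence in a structure. -/
def Sentence.value {L : MMLanguage.{u}} (φ : Sentence L) (M : MMStructure L) : ℝ :=
  Formula.eval M φ Fin.elim0

/-! ### Theories, elementary classes, elementary equivalence -/

/-- Closed statements `φ = ψ` and `φ ≤ ψ`. -/
inductive ClosedStatement (L : MMLanguage.{u}) : Type u
  | eq : Sentence L → Sentence L → ClosedStatement L
  | le : Sentence L → Sentence L → ClosedStatement L

/-- The closed statement holds in `M`. -/
def ClosedStatement.Holds {L : MMLanguage.{u}} (M : MMStructure L) : ClosedStatement L → Prop
  | .eq φ ψ => Sentence.value φ M = Sentence.value ψ M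
  | .le φ ψ => Sentence.value φ M ≤ Sentence.value ψ M

/-- A class of structures is elementary if it is the class of all models of some set of closed
statements. -/
def IsElementaryClass {L : MMLanguage.{u}} (K : Set (MMStructure L)) : Prop :=
  ∃ T : Set (ClosedStatement L), K = {M | ∀ σ ∈ T, σ.Holds M}

/-- Elementary equivalence: all sentences have the same value. -/
def ElementarilyEquivalent {L : MMLanguage.{u}} (M N : MMStructure L) : Prop :=
  ∀ φ : Sentence L, Sentence.value φ M = Sentence.value φ N

/-- If a member of `K` is elementarily equivalent to `N`, then `N` is in `K`. -/
def ClosedUnderElementaryEquivalence {L : MMLanguage.{u}} (K : Set (MMStructure L)) : Prop :=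
  ∀ M N : MMStructure L, M ∈ K → ElementarilyEquivalent M N → N ∈ K

/-! ### Limits along an ultrafilter -/

/-- The limit of a family of numbers along an ultrafilter. -/
def ulim {X I : Type*} [TopologicalSpace X] [Nonempty X] (D : Ultrafilter I) (f : I → X) : X :=
  limUnder (D : Filter I) f

theorem tendsto_ulim {X I : Type*} [TopologicalSpace X] [Nonempty X] (D : Ultrafilter I)
    {f : I → X} {s : Set X} (hs : IsCompact s) (hf : ∀ i, f i ∈ s) :
    Tendsto f D (𝓝 (ulim D f)) := by
  obtain ⟨x, -, hx⟩ := hs.ultrafilter_le_nhds (D.map f) (by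
    rw [le_principal_iff]
    exact Filter.mem_map.2 (Filter.Eventually.of_forall hf))
  exact tendsto_nhds_limUnder ⟨x, hx⟩

theorem tendsto_ulim_of_abs_le {I : Type*} (D : Ultrafilter I) {f : I → ℝ} {b : ℝ}
    (hf : ∀ i, |f i| ≤ b) : Tendsto f D (𝓝 (ulim D f)) :=
  tendsto_ulim D (isCompact_Icc (a := -b) (b := b)) fun i => abs_le.1 (hf i)

theorem ulim_congr {X I : Type*} [TopologicalSpace X] [Nonempty X] (D : Ultrafilter I)
    {f g : I → X} (h : ∀ᶠ i in (D : Filter I), f i = g i) : ulim D f = ulim D g := by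
  unfold ulim limUnder
  rw [Filter.map_congr h]

/-! ### The ultraproduct of metric structures -/

section MetricUltraproduct

variable {L : MMLanguage.{u}} {I : Type u} (D : Ultrafilter I) (M : I → MetricStructure L)

theorem tendsto_dist (a b : ∀ i, (M i).carrier) :
    Tendsto (fun i => dist (a i) (b i)) D (𝓝 (ulim D fun i => dist (a i) (b i))) :=
  tendsto_ulim_of_abs_le D (b := 1) fun i => by
    rw [abs_of_nonneg dist_nonneg]; exact (M i).dist_le_one _ _

/-- The set-theoretic ultraproduct: families modulo equality on a set in `D`. -/
def SetUltraproduct : Type u := Filter.Product (D : Filter I) fun i => (M i).carrier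

variable {M} in
/-- The class `[aᵢ]` of a family. -/
def SetUltraproduct.mk (a : ∀ i, (M i).carrier) : SetUltraproduct D M :=
  Quotient.mk (Filter.productSetoid (D : Filter I) fun i => (M i).carrier) a

variable {D M} in
theorem SetUltraproduct.exists_rep (x : SetUltraproduct D M) :
    ∃ a, SetUltraproduct.mk D a = x := Quotient.exists_rep x

variable {D M} in
theorem SetUltraproduct.mk_eq_mk {a b : ∀ i, (M i).carrier} :
    SetUltraproduct.mk D a = SetUltraproduct.mk D b ↔ ∀ᶠ i in (D : Filter I), a i = b i :=
  Quotient.eq (r := Filter.productSetoid (D : Filter I) fun i => (M i).carrier)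

/-- The pseudometric `ρ([aᵢ], [bᵢ]) = lim_D ρᵢ(aᵢ, bᵢ)`. -/
instance : PseudoMetricSpace (SetUltraproduct D M) where
  dist := Quotient.lift₂ (fun a b => ulim D fun i => dist (a i) (b i)) fun a b a' b' h h' =>
    ulim_congr D (by
      have h : ∀ᶠ i in (D : Filter I), a i = a' i := h
      have h' : ∀ᶠ i in (D : Filter I), b i = b' i := h'
      filter_upwards [h, h'] with i hi hi'
      rw [hi, hi'])
  dist_self x := by
    obtain ⟨a, rfl⟩ := x.exists_rep
    have h := tendsto_dist D M a a
    simp only [dist_self] at h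
    change ulim D (fun i => dist (a i) (a i)) = 0
    simp only [dist_self]
    exact tendsto_nhds_unique h tendsto_const_nhds
  dist_comm x y := by
    obtain ⟨a, rfl⟩ := x.exists_rep
    obtain ⟨b, rfl⟩ := y.exists_rep
    exact congrArg (ulim D) (funext fun i => dist_comm _ _)
  dist_triangle x y z := by
    obtain ⟨a, rfl⟩ := x.exists_rep
    obtain ⟨b, rfl⟩ := y.exists_rep
    obtain ⟨c, rfl⟩ := z.exists_rep
    exact le_of_tendsto_of_tendsto' (tendsto_dist D M a c)
      ((tendsto_dist D M a b).add (tendsto_dist D M b c)) fun i => dist_triangle _ _ _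

/-- The metric space `M̂` obtained from the set-theoretic ultraproduct by identifying points at
distance `0`. -/
abbrev UltraproductCarrier : Type u := SeparationQuotient (SetUltraproduct D M)

variable {M} in
/-- The point of `M̂` given by a family. -/
def UltraproductCarrier.mk (a : ∀ i, (M i).carrier) : UltraproductCarrier D M :=
  SeparationQuotient.mk (SetUltraproduct.mk D a)

variable {D M} in
theorem UltraproductCarrier.exists_rep (x : UltraproductCarrier D M) :
    ∃ a, UltraproductCarrier.mk D a = x := by
  obtain ⟨y, rfl⟩ := SeparationQuotient.surjective_mk x
  obtain ⟨a, rfl⟩ := y.exists_rep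
  exact ⟨a, rfl⟩

variable {D M} in
/-- A choice of a family representing a point of `M̂`. -/
def UltraproductCarrier.rep (x : UltraproductCarrier D M) : ∀ i, (M i).carrier :=
  x.exists_rep.choose

variable {D M} in
theorem UltraproductCarrier.mk_rep (x : UltraproductCarrier D M) :
    UltraproductCarrier.mk D x.rep = x := x.exists_rep.choose_spec

theorem UltraproductCarrier.dist_mk (a b : ∀ i, (M i).carrier) :
    dist (UltraproductCarrier.mk D a) (UltraproductCarrier.mk D b)
      = ulim D fun i => dist (a i) (b i) := rfl

theorem eventually_dist_lt {n : ℕ} {δ : ℝ} (a b : Fin n → ∀ i, (M i).carrier) (hδ : 0 < δ)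
    (h : dist (fun k => UltraproductCarrier.mk D (a k)) (fun k => UltraproductCarrier.mk D (b k))
      < δ) : ∀ᶠ i in (D : Filter I), dist (fun k => a k i) (fun k => b k i) < δ := by
  rw [dist_pi_lt_iff hδ] at h
  have h' : ∀ᶠ i in (D : Filter I), ∀ k, dist (a k i) (b k i) < δ :=
    Filter.eventually_all.2 fun k => (tendsto_dist D M (a k) (b k)).eventually_lt_const (h k)
  filter_upwards [h'] with i hi
  exact (dist_pi_lt_iff hδ).2 hi

theorem fn_aux (F : L.Fn) {ε : ℝ} (hε : 0 < ε) (a b : Fin (L.fnArity F) → ∀ i, (M i).carrier)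
    (h : dist (fun k => UltraproductCarrier.mk D (a k)) (fun k => UltraproductCarrier.mk D (b k))
      < L.fnModulus F ε) :
    dist (UltraproductCarrier.mk D fun i => (M i).fn F fun k => a k i)
      (UltraproductCarrier.mk D fun i => (M i).fn F fun k => b k i) ≤ ε := by
  rw [UltraproductCarrier.dist_mk]
  refine le_of_tendsto (tendsto_dist D M _ _) ?_
  filter_upwards [eventually_dist_lt D M a b (L.fnModulus_pos F ε hε) h] with i hi
  exact (M i).fn_modulus F ε hε _ _ hi

theorem tendsto_rel (R : L.Rel) (a : Fin (L.relArity R) → ∀ i, (M i).carrier) :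
    Tendsto (fun i => (M i).rel R fun k => a k i) D
      (𝓝 (ulim D fun i => (M i).rel R fun k => a k i)) :=
  tendsto_ulim_of_abs_le D fun i => (M i).rel_bound R _

theorem rel_aux (R : L.Rel) {ε : ℝ} (hε : 0 < ε) (a b : Fin (L.relArity R) → ∀ i, (M i).carrier)
    (h : dist (fun k => UltraproductCarrier.mk D (a k)) (fun k => UltraproductCarrier.mk D (b k))
      < L.relModulus R ε) :
    dist (ulim D fun i => (M i).rel R fun k => a k i)
      (ulim D fun i => (M i).rel R fun k => b k i) ≤ ε := by
  refine le_of_tendsto ((tendsto_rel D M R a).dist (tendsto_rel D M R b)) ?_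
  filter_upwards [eventually_dist_lt D M a b (L.relModulus_pos R ε hε) h] with i hi
  exact (M i).rel_modulus R ε hε _ _ hi

/-- The metric structure `M̂`: the symbols are interpreted by applying the interpretations in the
`Mᵢ` to representing families.  The choice of these is irrelevant by `metricUltraproduct_fn_mk` and
`metricUltraproduct_rel_mk` below. -/
def metricUltraproduct : MetricStructure L where
  carrier := UltraproductCarrier D M
  metric := inferInstance
  nonempty := ⟨UltraproductCarrier.mk D fun _ => Classical.arbitrary _⟩
  dist_le_one x y := by
    rw [← x.mk_rep, ← y.mk_rep, UltraproductCarrier.dist_mk]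
    exact le_of_tendsto' (tendsto_dist D M _ _) fun i => (M i).dist_le_one _ _
  const c := UltraproductCarrier.mk D fun i => (M i).const c
  fn F x := UltraproductCarrier.mk D fun i => (M i).fn F fun k => (x k).rep i
  rel R x := ulim D fun i => (M i).rel R fun k => (x k).rep i
  rel_bound R x := le_of_tendsto' (tendsto_rel D M R fun k => (x k).rep).abs
    fun i => (M i).rel_bound R _
  fn_modulus F ε hε x y h := fn_aux D M F hε _ _ (by
    simpa only [UltraproductCarrier.mk_rep] using h)
  rel_modulus R ε hε x y h := rel_aux D M R hε _ _ (by
    simpa only [UltraproductCarrier.mk_rep] using h)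

theorem metricUltraproduct_fn_mk (F : L.Fn) (a : Fin (L.fnArity F) → ∀ i, (M i).carrier) :
    (metricUltraproduct D M).fn F (fun k => UltraproductCarrier.mk D (a k))
      = UltraproductCarrier.mk D fun i => (M i).fn F fun k => a k i := by
  refine eq_of_forall_dist_le fun ε hε => fn_aux D M F hε _ _ ?_
  simp only [UltraproductCarrier.mk_rep, dist_self]
  exact L.fnModulus_pos F ε hε

theorem metricUltraproduct_rel_mk (R : L.Rel) (a : Fin (L.relArity R) → ∀ i, (M i).carrier) :
    (metricUltraproduct D M).rel R (fun k => UltraproductCarrier.mk D (a k))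
      = ulim D fun i => (M i).rel R fun k => a k i := by
  refine eq_of_forall_dist_le fun ε hε => rel_aux D M R hε _ _ ?_
  simp only [UltraproductCarrier.mk_rep, dist_self]
  exact L.relModulus_pos R ε hε

/-- The quotient map from the set-theoretic ultraproduct to `M̂`. -/
def toUltraproduct (x : SetUltraproduct D M) : (metricUltraproduct D M).carrier :=
  (SeparationQuotient.mk x : UltraproductCarrier D M)

variable {M} in
/-- The ultrabox `[Aᵢ]`: all `[aᵢ]` with `aᵢ ∈ Aᵢ` for `D`-almost all `i`. -/
def ultrabox (A : ∀ i, Set (M i).carrier) : Set (SetUltraproduct D M) :=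
  {x | ∃ a, SetUltraproduct.mk D a = x ∧ ∀ᶠ i in (D : Filter I), a i ∈ A i}

variable {D M} in
theorem mk_mem_ultrabox {A : ∀ i, Set (M i).carrier} {a : ∀ i, (M i).carrier} :
    SetUltraproduct.mk D a ∈ ultrabox D A ↔ ∀ᶠ i in (D : Filter I), a i ∈ A i := by
  refine ⟨?_, fun h => ⟨a, rfl, h⟩⟩
  rintro ⟨b, hb, h⟩
  filter_upwards [h, SetUltraproduct.mk_eq_mk.1 hb] with i hi hi'
  rwa [← hi']

/-- The `σ`-algebra generated by the ultraboxes of families of Borel sets. -/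
abbrev ultraboxSigma : MeasurableSpace (SetUltraproduct D M) :=
  MeasurableSpace.generateFrom
    {S | ∃ A : ∀ i, Set (M i).carrier, (∀ i, MeasurableSet (A i)) ∧ S = ultrabox D A}

end MetricUltraproduct

/-! ### The ultraproduct measure -/

section MeasureUltraproduct

variable {L : MMLanguage.{u}} {I : Type u} (D : Ultrafilter I) (M : I → MMStructure L)

/-- The value `lim_D μᵢ(Aᵢ)` attached to the ultrabox `[Aᵢ]`. -/
def ultraboxMass (A : ∀ i, Set (M i).carrier) : ENNReal := ulim D fun i => (M i).measure (A i)

theorem tendsto_ultraboxMass (A : ∀ i, Set (M i).carrier) :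
    Tendsto (fun i => (M i).measure (A i)) D (𝓝 (ultraboxMass D M A)) :=
  tendsto_ulim D isCompact_univ fun _ => mem_univ _

/-- The least value of an ultrabox containing `S`. -/
def ultraContent (S : Set (SetUltraproduct D fun i => (M i).toMetricStructure)) : ENNReal :=
  ⨅ (A : ∀ i, Set (M i).carrier) (_ : ∀ i, MeasurableSet (A i)) (_ : S ⊆ ultrabox D A),
    ultraboxMass D M A

theorem ultraContent_empty : ultraContent D M ∅ = 0 := by
  refine le_antisymm ?_ zero_le
  refine iInf_le_of_le (fun _ => ∅) (iInf_le_of_le (fun _ => MeasurableSet.empty)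
    (iInf_le_of_le (empty_subset _) ?_))
  have h := tendsto_ultraboxMass D M fun _ => ∅
  simp only [measure_empty] at h
  exact (tendsto_nhds_unique h tendsto_const_nhds).le

/-- The outer measure `S ↦ inf {∑ₖ lim_D μᵢ(Aᵢᵏ) : S ⊆ ⋃ₖ [Aᵢᵏ]}`. -/
def ultraOuterMeasure : OuterMeasure (SetUltraproduct D fun i => (M i).toMetricStructure) :=
  OuterMeasure.ofFunction (ultraContent D M) (ultraContent_empty D M)

theorem ultraboxSigma_le_caratheodory :
    ultraboxSigma D (fun i => (M i).toMetricStructure) ≤ (ultraOuterMeasure D M).caratheodory := by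
  refine MeasurableSpace.generateFrom_le ?_
  rintro _ ⟨B, hB, rfl⟩
  refine OuterMeasure.ofFunction_caratheodory fun S => ?_
  refine le_iInf fun A => le_iInf fun hA => le_iInf fun hS => ?_
  have h1 : ultraContent D M (S ∩ ultrabox D B) ≤ ultraboxMass D M fun i => A i ∩ B i := by
    refine iInf_le_of_le _ (iInf_le_of_le (fun i => (hA i).inter (hB i)) (iInf_le_of_le ?_ le_rfl))
    rintro x ⟨hxS, hxB⟩
    obtain ⟨a, rfl⟩ := x.exists_rep
    exact mk_mem_ultrabox.2 ((mk_mem_ultrabox.1 (hS hxS)).and (mk_mem_ultrabox.1 hxB))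
  have h2 : ultraContent D M (S \ ultrabox D B) ≤ ultraboxMass D M fun i => A i \ B i := by
    refine iInf_le_of_le _ (iInf_le_of_le (fun i => (hA i).diff (hB i)) (iInf_le_of_le ?_ le_rfl))
    rintro x ⟨hxS, hxB⟩
    obtain ⟨a, rfl⟩ := x.exists_rep
    exact mk_mem_ultrabox.2 ((mk_mem_ultrabox.1 (hS hxS)).and
      (Ultrafilter.eventually_not.2 fun h => hxB (mk_mem_ultrabox.2 h)))
  refine (add_le_add h1 h2).trans (le_of_eq ?_)
  refine tendsto_nhds_unique ((tendsto_ultraboxMass D M fun i => A i ∩ B i).add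
    (tendsto_ultraboxMass D M fun i => A i \ B i)) ?_
  simp only [measure_inter_add_sdiff _ (hB _)]
  exact tendsto_ultraboxMass D M A

/-- The ultraproduct measure on the set-theoretic ultraproduct: the Carathéodory extension of
`[Aᵢ] ↦ lim_D μᵢ(Aᵢ)` to the `σ`-algebra generated by the ultraboxes. -/
def ultraMeasure :
    @Measure (SetUltraproduct D fun i => (M i).toMetricStructure) (ultraboxSigma D _) :=
  @OuterMeasure.toMeasure _ (ultraboxSigma D _) (ultraOuterMeasure D M)
    (ultraboxSigma_le_caratheodory D M)

/-- The `σ`-algebra generated by the open balls. -/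
abbrev ballSigma (X : Type*) [PseudoMetricSpace X] : MeasurableSpace X :=
  MeasurableSpace.generateFrom {B | ∃ (x : X) (r : ℝ), B = Metric.ball x r}

/-- The metric structure `M̂` of a family of metric-measure structures. -/
abbrev mmUltraproductBase : MetricStructure L :=
  metricUltraproduct D fun i => (M i).toMetricStructure

/-- `ν` is the ultraproduct measure on `M̂`: a Borel measure that extends the restriction to the
`σ`-algebra generated by the open balls of the push-forward of `ultraMeasure` to `M̂`. -/
def IsUltraproductMeasure (ν : Measure (mmUltraproductBase D M).carrier) : Prop :=
  ∀ B, MeasurableSet[ballSigma (mmUltraproductBase D M).carrier] B →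
    ν B = ultraMeasure D M (toUltraproduct D _ ⁻¹' B)

end MeasureUltraproduct

/-- `N` is the ultraproduct of the family `M` of metric-measure structures with respect to `D`: its
underlying metric structure is `M̂`, and its measure is the ultraproduct measure. -/
def IsUltraproduct {L : MMLanguage.{u}} {I : Type u} (D : Ultrafilter I) (M : I → MMStructure L)
    (N : MMStructure L) : Prop :=
  ∃ (ν : Measure (mmUltraproductBase D M).carrier) (h : ν univ ≤ 1),
    IsUltraproductMeasure D M ν ∧
      N = { mmUltraproductBase D M with measure := ν, measure_univ_le := h }

/-- All (existing) ultraproducts of families of members of `K` are in `K`. -/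
def ClosedUnderUltraproducts {L : MMLanguage.{u}} (K : Set (MMStructure L)) : Prop :=
  ∀ (I : Type u) (D : Ultrafilter I) (M : I → MMStructure L), (∀ i, M i ∈ K) →
    ∀ N, IsUltraproduct D M N → N ∈ K

/-! ### The set-theoretic assumption -/

/-- `μ(⋃ᵢ Uᵢ) = supᵢ μ(Uᵢ)` for upward directed families of open sets. -/
def IsTauAdditive {X : Type*} [TopologicalSpace X] [MeasurableSpace X] (μ : Measure X) : Prop :=
  ∀ 𝒰 : Set (Set X), (∀ U ∈ 𝒰, IsOpen U) → DirectedOn (· ⊆ ·) 𝒰 → μ (⋃₀ 𝒰) = ⨆ U ∈ 𝒰, μ U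

/-- Every finite Borel measure on a metric space is `τ`-additive. -/
def BorelMeasuresTauAdditive : Prop :=
  ∀ (X : Type u) [MetricSpace X] [MeasurableSpace X] [BorelSpace X] (μ : Measure X)
    [IsFiniteMeasure μ], IsTauAdditive μ

end

end ContIntLogic

namespace ContIntLogic

noncomputable section

/-! ### Continuity and boundedness of formulas -/

/-! Necessity rests on Łoś's theorem (`Formula.tendsto_eval`): in an existing ultraproduct every
sentence has the ultralimit of its values, and closed statements survive limits. The delicate case
is the integral, since the measure on `M̂` is prescribed only on the `σ`-algebra generated by the
balls. By `τ`-additivity an open set is exhausted in measure by its ball-measurable open subsets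
(`measure_open_le`), so superlevel sets of a limit function have at most the limiting measure.
Summing over levels bounds its integral above by the limit of the integrals; the same bound for the
negated function gives equality.

Sufficiency: let `N` satisfy every closed statement true in `K`. Finitely many sentence values of
`N` are approximated by a member of `K`, since otherwise a lower bound on the total deviation would
hold throughout `K` but fail in `N`. An ultrafilter on pairs (finite set of sentences, precision)
then yields a family in `K` whose sentence values converge to those of `N`. Its ultraproduct must be
shown to exist. By `τ`-additivity finitely many small balls cover almost all of the mass of `N`;
this is expressed by a sentence, so it passes to almost all members of the family. The ultraproduct
measure therefore lives on a separable closed set, where balls generate all Borel sets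
(`exists_isUltraproduct_of_tight`). By Łoś the ultraproduct is elementarily equivalent to `N`, so
`N` is in `K`. -/

theorem UniformlyContinuousWithModulus.uniformContinuous {X Y : Type*} [PseudoMetricSpace X]
    [PseudoMetricSpace Y] {Δ : ℝ → ℝ} {f : X → Y} (hΔ : ∀ ε, 0 < ε → 0 < Δ ε)
    (hf : UniformlyContinuousWithModulus Δ f) : UniformContinuous f := by
  rw [Metric.uniformContinuous_iff]
  intro ε hε
  exact ⟨Δ (ε / 2), hΔ _ (half_pos hε), fun x y h =>
    (hf _ (half_pos hε) x y h).trans_lt (half_lt_self hε)⟩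

theorem Term.uniformContinuous_eval {L : MMLanguage.{u}} (M : MetricStructure L) {n : ℕ}
    (t : Term L n) : UniformContinuous (t.eval M) := by
  induction t with
  | var i => exact Pi.uniformContinuous_proj (fun _ : Fin n => M.carrier) i
  | const c => exact uniformContinuous_const
  | app F t ih =>
    exact ((M.fn_modulus F).uniformContinuous (L.fnModulus_pos F)).comp
      (uniformContinuous_pi.2 ih)

/-- A bound for the absolute value of a formula in all structures. -/
def Formula.bound {L : MMLanguage.{u}} : {n : ℕ} → Formula L n → ℝ
  | _, .one => 1
  | _, .rho _ _ => 1
  | _, .rel R _ => L.relBound R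
  | _, .smul r φ => |r| * φ.bound
  | _, .add φ ψ => φ.bound + ψ.bound
  | _, .inf φ ψ => max φ.bound ψ.bound
  | _, .sup φ => φ.bound
  | _, .integral φ => φ.bound

instance {L : MMLanguage.{u}} (M : MMStructure L) : IsFiniteMeasure M.measure :=
  ⟨M.measure_univ_le.trans_lt ENNReal.one_lt_top⟩

theorem MMStructure.measureReal_univ_le {L : MMLanguage.{u}} (M : MMStructure L) :
    M.measure.real univ ≤ 1 :=
  ENNReal.toReal_le_of_le_ofReal zero_le_one (by simpa using M.measure_univ_le)

theorem MMStructure.norm_integral_le {L : MMLanguage.{u}} (M : MMStructure L)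
    {f : M.carrier → ℝ} {C : ℝ} (hC : 0 ≤ C) (hf : ∀ x, |f x| ≤ C) :
    |∫ x, f x ∂M.measure| ≤ C := by
  refine (norm_integral_le_of_norm_le_const (μ := M.measure) (f := f) (C := C)
    (Eventually.of_forall hf)).trans ?_
  exact mul_le_of_le_one_right hC M.measureReal_univ_le

theorem Formula.abs_eval_le {L : MMLanguage.{u}} (M : MMStructure L) {n : ℕ} (φ : Formula L n)
    (a : Fin n → M.carrier) : |φ.eval M a| ≤ φ.bound := by
  induction φ with
  | one => simp [Formula.eval, Formula.bound]
  | rho s t =>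
    simp only [Formula.eval, Formula.bound, abs_of_nonneg dist_nonneg]
    exact M.dist_le_one _ _
  | rel R t => exact M.rel_bound R _
  | smul r φ ih =>
    simp only [Formula.eval, Formula.bound, abs_mul]
    exact mul_le_mul_of_nonneg_left (ih a) (abs_nonneg r)
  | add φ ψ ih₁ ih₂ => exact (abs_add_le _ _).trans (add_le_add (ih₁ a) (ih₂ a))
  | inf φ ψ ih₁ ih₂ => exact abs_min_le_max_abs_abs.trans (max_le_max (ih₁ a) (ih₂ a))
  | sup φ ih =>
    simp only [Formula.eval, Formula.bound]
    refine abs_le.2 ⟨?_, ciSup_le fun b => (abs_le.1 (ih _)).2⟩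
    obtain ⟨b⟩ := M.nonempty
    exact (abs_le.1 (ih _)).1.trans (le_ciSup (f := fun b : M.carrier =>
      φ.eval M (Fin.snoc (α := fun _ => M.carrier) a b))
      ⟨φ.bound, forall_mem_range.2 fun _ => (abs_le.1 (ih _)).2⟩ b)
  | integral φ ih =>
    obtain ⟨b⟩ := M.nonempty
    exact M.norm_integral_le ((abs_nonneg _).trans
      (ih (Fin.snoc (α := fun _ => M.carrier) a b))) fun b => ih _

theorem Formula.bddAbove_range_eval {L : MMLanguage.{u}} (M : MMStructure L) {n : ℕ}
    (φ : Formula L (n + 1)) (a : Fin n → M.carrier) :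
    BddAbove (range fun b : M.carrier =>
      φ.eval M (Fin.snoc (α := fun _ => M.carrier) a b)) :=
  ⟨φ.bound, forall_mem_range.2 fun _ => (abs_le.1 (φ.abs_eval_le M _)).2⟩

theorem uniformContinuous_snoc (X : Type*) [UniformSpace X] (n : ℕ) :
    UniformContinuous fun p : (Fin n → X) × X => (Fin.snoc (α := fun _ => X) p.1 p.2) := by
  refine uniformContinuous_pi.2 fun k => ?_
  induction k using Fin.lastCases with
  | last => simpa using uniformContinuous_snd
  | cast k =>
    simpa [Function.comp_def] using (Pi.uniformContinuous_proj (fun _ : Fin n => X) k).comp uniformContinuous_fst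

theorem Formula.exists_dist_eval_snoc_le {L : MMLanguage.{u}} {M : MMStructure L} {n : ℕ}
    {φ : Formula L (n + 1)} (h : UniformContinuous (φ.eval M)) {ε : ℝ} (hε : 0 < ε) :
    ∃ δ > 0, ∀ a a' : Fin n → M.carrier, dist a a' < δ → ∀ b,
      |φ.eval M (Fin.snoc (α := fun _ => M.carrier) a b) -
        φ.eval M (Fin.snoc (α := fun _ => M.carrier) a' b)| ≤ ε := by
  obtain ⟨δ, hδ, H⟩ := Metric.uniformContinuous_iff.1
    (h.comp (uniformContinuous_snoc M.carrier n)) ε hε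
  refine ⟨δ, hδ, fun a a' haa' b => ?_⟩
  have := H (a := (a, b)) (b := (a', b)) (by simpa [Prod.dist_eq] using haa')
  exact this.le

theorem Formula.continuous_eval_snoc {L : MMLanguage.{u}} {M : MMStructure L} {n : ℕ}
    {φ : Formula L (n + 1)} (h : UniformContinuous (φ.eval M)) (a : Fin n → M.carrier) :
    Continuous fun b => φ.eval M (Fin.snoc (α := fun _ => M.carrier) a b) :=
  (h.comp (uniformContinuous_snoc M.carrier n)).continuous.comp
    (continuous_const.prodMk continuous_id : Continuous fun b : M.carrier => (a, b))

theorem MMStructure.integrable {L : MMLanguage.{u}} (M : MMStructure L)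
    {f : M.carrier → ℝ} {C : ℝ} (hf : Continuous f) (hC : ∀ x, |f x| ≤ C) :
    Integrable f M.measure :=
  Integrable.of_bound hf.measurable.aestronglyMeasurable C (Eventually.of_forall hC)

/-- Integrals and superlevel sets only need continuity, but the induction needs uniformity: for
`sup` and `integral` one `δ` must serve all values of the bound variable. -/
theorem Formula.uniformContinuous_eval {L : MMLanguage.{u}} (M : MMStructure L) {n : ℕ}
    (φ : Formula L n) : UniformContinuous (φ.eval M) := by
  induction φ with
  | one => exact uniformContinuous_const
  | rho s t => exact (s.uniformContinuous_eval _).dist (t.uniformContinuous_eval _)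
  | rel R t =>
    exact ((M.rel_modulus R).uniformContinuous (L.relModulus_pos R)).comp
      (uniformContinuous_pi.2 fun k => (t k).uniformContinuous_eval _)
  | smul r φ ih => exact ih.const_mul' r
  | add φ ψ ih₁ ih₂ => exact ih₁.add ih₂
  | inf φ ψ ih₁ ih₂ =>
    rw [Metric.uniformContinuous_iff] at ih₁ ih₂ ⊢
    intro ε hε
    obtain ⟨δ₁, hδ₁, h₁⟩ := ih₁ ε hε
    obtain ⟨δ₂, hδ₂, h₂⟩ := ih₂ ε hε
    exact ⟨min δ₁ δ₂, lt_min hδ₁ hδ₂, fun {_ _} h => (abs_min_sub_min_le_max _ _ _ _).trans_lt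
      (max_lt (h₁ (h.trans_le (min_le_left _ _))) (h₂ (h.trans_le (min_le_right _ _))))⟩
  | sup φ ih =>
    rw [Metric.uniformContinuous_iff]
    intro ε hε
    obtain ⟨δ, hδ, H⟩ := exists_dist_eval_snoc_le ih (half_pos hε)
    have key : ∀ a a' : Fin _ → M.carrier, dist a a' < δ →
        φ.sup.eval M a ≤ φ.sup.eval M a' + ε / 2 := fun a a' h => by
      refine ciSup_le fun b => ?_
      have h1 := le_ciSup (φ.bddAbove_range_eval M a') b
      have h2 := (abs_le.1 (H a a' h b)).2
      simp only [Formula.eval]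
      linarith
    refine ⟨δ, hδ, fun {a a'} h => ?_⟩
    rw [Real.dist_eq]
    refine lt_of_le_of_lt (abs_le.2 ⟨?_, ?_⟩) (half_lt_self hε)
    · linarith [key a' a (by rwa [dist_comm])]
    · linarith [key a a' h]
  | integral φ ih =>
    rw [Metric.uniformContinuous_iff]
    intro ε hε
    obtain ⟨δ, hδ, H⟩ := exists_dist_eval_snoc_le ih (half_pos hε)
    refine ⟨δ, hδ, fun {a a'} h => ?_⟩
    rw [Real.dist_eq]
    simp only [Formula.eval]
    rw [← integral_sub (M.integrable (continuous_eval_snoc ih a) fun b => φ.abs_eval_le M _)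
      (M.integrable (continuous_eval_snoc ih a') fun b => φ.abs_eval_le M _)]
    exact (M.norm_integral_le (half_pos hε).le (H a a' h)).trans_lt (half_lt_self hε)

/-! ### The ultraproduct measure of an ultrabox -/

/-- Take countably many members of `D` whose intersection is not in `D`. The complement of that
intersection is in `D`, so deleting the intersection from each member stays inside `D`. -/
theorem exists_seq_iInter_eq_empty_of_not_countableInter {I : Type*} {D : Ultrafilter I}
    (hD : ¬ CountableInterFilter (D : Filter I)) :
    ∃ X : ℕ → Set I, (∀ n, X n ∈ D) ∧ ⋂ n, X n = ∅ := by
  have : ∃ S : Set (Set I), S.Countable ∧ (∀ s ∈ S, s ∈ (D : Filter I)) ∧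
      ⋂₀ S ∉ (D : Filter I) := by
    by_contra! h
    exact hD ⟨h⟩
  obtain ⟨S, hS, hSD, hSI⟩ := this
  have hc : (⋂₀ S)ᶜ ∈ D := Ultrafilter.compl_mem_iff_notMem.2 hSI
  have hne : S.Nonempty := by
    by_contra h
    rw [not_nonempty_iff_eq_empty] at h
    simp [h] at hSI
  obtain ⟨Y, rfl⟩ := hS.exists_eq_range hne
  refine ⟨fun n => Y n \ ⋂₀ range Y, fun n => ?_, ?_⟩
  · exact inter_mem (hSD _ (mem_range_self n)) hc
  · ext i
    simp only [mem_iInter, Set.mem_sdiff, mem_empty_iff_false, iff_false, not_forall]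
    by_contra! h
    exact (h 0).2 (mem_sInter.2 (forall_mem_range.2 fun n => (h n).1))

section Ultraboxes

variable {L : MMLanguage.{u}} {I : Type u} {D : Ultrafilter I}

/-- Countable saturation of ultraproducts with respect to countably incomplete ultrafilters. -/
theorem exists_finite_subcover_of_ultrabox_subset {M : I → MetricStructure L}
    (hD : ¬ CountableInterFilter (D : Filter I)) {A : ∀ i, Set (M i).carrier}
    {B : ℕ → ∀ i, Set (M i).carrier} (h : ultrabox D A ⊆ ⋃ k, ultrabox D (B k)) :
    ∃ n, ∀ᶠ i in (D : Filter I), A i ⊆ ⋃ k ∈ Finset.range n, B k i := by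
  classical
  obtain ⟨X, hX, hX0⟩ := exists_seq_iInter_eq_empty_of_not_countableInter hD
  by_contra! hn
  set S : ℕ → Set I := fun n => {i | ¬ A i ⊆ ⋃ k ∈ Finset.range n, B k i} with hS
  have hSD : ∀ n, S n ∈ D := hn
  -- `p i n` says that the first `n` constraints can be met at `i`
  set p : I → ℕ → Prop := fun i n => ∀ m ≤ n, i ∈ S m ∩ X m with hp
  have hpD : ∀ n, ∀ᶠ i in (D : Filter I), p i n := fun n => by
    have : ∀ᶠ i in (D : Filter I), ∀ m ∈ Finset.range (n + 1), i ∈ S m ∩ X m :=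
      (Finset.eventually_all _).2 fun m _ => inter_mem (hSD m) (hX m)
    filter_upwards [this] with i hi m hm
    exact hi m (Finset.mem_range.2 (Nat.lt_succ_of_le hm))
  -- Since the `X n` have empty intersection, only finitely many stages are available at each `i`.
  have hbd : ∀ i, ∃ n, ¬ p i n := fun i => by
    by_contra! h
    have : i ∈ ⋂ n, X n := mem_iInter.2 fun n => (h n n le_rfl).2
    simp [hX0] at this
  -- A point chosen for the last available stage at `i` serves all earlier stages as well; if no
  -- stage is available, any point will do.
  have hex : ∀ i, ∃ a : (M i).carrier, ∀ n, p i n → a ∈ A i ∧ ∀ k < n, a ∉ B k i := fun i => by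
    rcases hfind : Nat.find (hbd i) with _ | N
    · obtain ⟨a⟩ := (M i).nonempty
      refine ⟨a, fun n hpn => (Nat.find_spec (hbd i) ?_).elim⟩
      rw [hfind]
      exact fun m hm => hpn m (hm.trans (Nat.zero_le n))
    · have hN : p i N := not_not.1 (Nat.find_min (hbd i) (hfind ▸ Nat.lt_succ_self N))
      obtain ⟨a, haA, haB⟩ := not_subset.1 (hN N le_rfl).1
      refine ⟨a, fun n hpn => ⟨haA, fun k hk hkB => haB ?_⟩⟩
      have hnN : n ≤ N := by
        by_contra! hlt
        refine Nat.find_spec (hbd i) ?_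
        rw [hfind]
        exact fun m hm => hpn m (hm.trans hlt)
      exact mem_biUnion (Finset.mem_coe.2 (Finset.mem_range.2 (hk.trans_le hnN))) hkB
  choose a ha using hex
  have haA : SetUltraproduct.mk D a ∈ ultrabox D A := mk_mem_ultrabox.2 (by
    filter_upwards [hpD 0] with i hi
    exact (ha i 0 hi).1)
  obtain ⟨k, hk⟩ := mem_iUnion.1 (h haA)
  obtain ⟨i, hi, hi'⟩ := ((mk_mem_ultrabox.1 hk).and (hpD (k + 1))).exists
  exact (ha i (k + 1) hi').2 k (Nat.lt_succ_self k) hi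

/-- Points outside all `B k i`, chosen at the indices where the inclusion fails, would form a class
in the first ultrabox but in none of the covering ones. This holds for every ultrafilter and is used
for the countably complete ones. -/
theorem eventually_subset_iUnion_of_ultrabox_subset {M : I → MetricStructure L}
    {A : ∀ i, Set (M i).carrier}
    {B : ℕ → ∀ i, Set (M i).carrier} (h : ultrabox D A ⊆ ⋃ k, ultrabox D (B k)) :
    ∀ᶠ i in (D : Filter I), A i ⊆ ⋃ k, B k i := by
  by_contra hn
  have hex : ∀ i, ∃ a : (M i).carrier, ¬ A i ⊆ (⋃ k, B k i) → a ∈ A i ∧ a ∉ ⋃ k, B k i :=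
    fun i => by
      obtain ⟨b⟩ := (M i).nonempty
      by_cases hi : A i ⊆ ⋃ k, B k i
      · exact ⟨b, fun h => (h hi).elim⟩
      · obtain ⟨a, ha⟩ := not_subset.1 hi
        exact ⟨a, fun _ => ha⟩
  choose a ha using hex
  have hn' := Ultrafilter.eventually_not.2 hn
  have haA : SetUltraproduct.mk D a ∈ ultrabox D A := mk_mem_ultrabox.2 (by
    filter_upwards [hn'] with i hi
    exact (ha i hi).1)
  obtain ⟨k, hk⟩ := mem_iUnion.1 (h haA)
  obtain ⟨i, hi, hi'⟩ := ((mk_mem_ultrabox.1 hk).and hn').exists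
  exact (ha i hi').2 (mem_iUnion.2 ⟨k, hi⟩)

/-! ### Countable subadditivity of ultrabox masses -/

variable {M : I → MMStructure L}

theorem ultraboxMass_mono {A B : ∀ i, Set (M i).carrier}
    (h : ∀ᶠ i in (D : Filter I), A i ⊆ B i) : ultraboxMass D M A ≤ ultraboxMass D M B :=
  le_of_tendsto_of_tendsto (tendsto_ultraboxMass D M A) (tendsto_ultraboxMass D M B)
    (h.mono fun _ hi => measure_mono hi)

theorem ultraboxMass_le_one (A : ∀ i, Set (M i).carrier) : ultraboxMass D M A ≤ 1 :=
  le_of_tendsto' (tendsto_ultraboxMass D M A) fun i =>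
    (measure_mono (subset_univ _)).trans (M i).measure_univ_le

theorem ultraboxMass_biUnion_le (B : ℕ → ∀ i, Set (M i).carrier) (s : Finset ℕ) :
    ultraboxMass D M (fun i => ⋃ k ∈ s, B k i) ≤ ∑ k ∈ s, ultraboxMass D M (B k) :=
  le_of_tendsto_of_tendsto' (tendsto_ultraboxMass D M _)
    (tendsto_finsetSum s fun k _ => tendsto_ultraboxMass D M (B k))
    fun _ => measure_biUnion_finset_le s _

/-- If `D` is countably complete, approximations of all the masses hold simultaneously at almost
every `i`, where countable subadditivity applies. Otherwise saturation reduces the cover to a finite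
one. -/
theorem ultraboxMass_le_tsum {A : ∀ i, Set (M i).carrier} {B : ℕ → ∀ i, Set (M i).carrier}
    (h : ultrabox D A ⊆ ⋃ k, ultrabox D (B k)) :
    ultraboxMass D M A ≤ ∑' k, ultraboxMass D M (B k) := by
  by_cases hD : CountableInterFilter (D : Filter I)
  · refine ENNReal.le_of_forall_pos_le_add fun ε hε hfin => ?_
    obtain ⟨ε', hε', hsum⟩ := ENNReal.exists_pos_sum_of_countable
      (ENNReal.coe_pos.2 hε).ne' ℕ
    have hk : ∀ k, ∀ᶠ i in (D : Filter I),
        (M i).measure (B k i) < ultraboxMass D M (B k) + ε' k := fun k =>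
      (tendsto_ultraboxMass D M (B k)).eventually_lt_const
        (ENNReal.lt_add_right ((ultraboxMass_le_one _).trans_lt ENNReal.one_lt_top).ne
          (ENNReal.coe_pos.2 (hε' k)).ne')
    refine le_of_tendsto (tendsto_ultraboxMass D M A) ?_
    filter_upwards [eventually_countable_forall.2 hk,
      eventually_subset_iUnion_of_ultrabox_subset h] with i hi hsub
    calc (M i).measure (A i) ≤ ∑' k, (M i).measure (B k i) :=
          (measure_mono hsub).trans (measure_iUnion_le _)
      _ ≤ ∑' k, (ultraboxMass D M (B k) + ε' k) := ENNReal.tsum_le_tsum fun k => (hi k).le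
      _ = ∑' k, ultraboxMass D M (B k) + ∑' k, (ε' k : ENNReal) := ENNReal.tsum_add
      _ ≤ _ := add_le_add_right hsum.le _
  · obtain ⟨n, hn⟩ := exists_finite_subcover_of_ultrabox_subset hD h
    exact (ultraboxMass_mono hn).trans ((ultraboxMass_biUnion_le B _).trans
      (ENNReal.sum_le_tsum _))

theorem ultraOuterMeasure_le {A : ∀ i, Set (M i).carrier} (hA : ∀ i, MeasurableSet (A i))
    {S : Set (SetUltraproduct D fun i => (M i).toMetricStructure)} (hS : S ⊆ ultrabox D A) :
    ultraOuterMeasure D M S ≤ ultraboxMass D M A :=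
  (OuterMeasure.ofFunction_le S).trans
    (iInf_le_of_le A (iInf_le_of_le hA (iInf_le_of_le hS le_rfl)))

/-- An arbitrary cover is enlarged to a cover by ultraboxes at arbitrarily small total cost, and
then `ultraboxMass_le_tsum` applies. -/
theorem ultraboxMass_le_ultraOuterMeasure (A : ∀ i, Set (M i).carrier) :
    ultraboxMass D M A ≤ ultraOuterMeasure D M (ultrabox D A) := by
  refine (le_of_le_of_eq ?_ (OuterMeasure.ofFunction_apply _ _ _).symm)
  refine le_iInf fun t => le_iInf fun ht => ?_
  -- The finiteness `hfin` makes each content finite, so that adding `ε' k` strictly increases it.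
  refine ENNReal.le_of_forall_pos_le_add fun ε hε hfin => ?_
  obtain ⟨ε', hε', hsum⟩ := ENNReal.exists_pos_sum_of_countable
    (ENNReal.coe_pos.2 hε).ne' ℕ
  have hB : ∀ k, ∃ B : ∀ i, Set (M i).carrier, t k ⊆ ultrabox D B ∧
      ultraboxMass D M B ≤ ultraContent D M (t k) + ε' k := fun k => by
    have hlt : ultraContent D M (t k) < ultraContent D M (t k) + ε' k :=
      ENNReal.lt_add_right ((ENNReal.le_tsum k).trans_lt hfin).ne (ENNReal.coe_pos.2 (hε' k)).ne'
    obtain ⟨B, hB⟩ := iInf_lt_iff.1 hlt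
    obtain ⟨-, hB⟩ := iInf_lt_iff.1 hB
    obtain ⟨hBt, hB⟩ := iInf_lt_iff.1 hB
    exact ⟨B, hBt, hB.le⟩
  choose B hBt hB using hB
  calc ultraboxMass D M A ≤ ∑' k, ultraboxMass D M (B k) :=
        ultraboxMass_le_tsum (ht.trans (iUnion_mono hBt))
    _ ≤ ∑' k, (ultraContent D M (t k) + ε' k) := ENNReal.tsum_le_tsum hB
    _ = ∑' k, ultraContent D M (t k) + ∑' k, (ε' k : ENNReal) := ENNReal.tsum_add
    _ ≤ _ := add_le_add_right hsum.le _

theorem measurableSet_ultrabox {M : I → MetricStructure L} {A : ∀ i, Set (M i).carrier}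
    (hA : ∀ i, MeasurableSet (A i)) : MeasurableSet[ultraboxSigma D M] (ultrabox D A) :=
  MeasurableSpace.measurableSet_generateFrom ⟨A, hA, rfl⟩

theorem ultraMeasure_apply {S : Set (SetUltraproduct D fun i => (M i).toMetricStructure)}
    (hS : MeasurableSet[ultraboxSigma D _] S) : ultraMeasure D M S = ultraOuterMeasure D M S :=
  @toMeasure_apply _ (ultraboxSigma D _) _ (ultraboxSigma_le_caratheodory D M) _ hS

theorem ultraMeasure_ultrabox {A : ∀ i, Set (M i).carrier} (hA : ∀ i, MeasurableSet (A i)) :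
    ultraMeasure D M (ultrabox D A) = ultraboxMass D M A := by
  rw [ultraMeasure_apply (measurableSet_ultrabox hA)]
  exact le_antisymm (ultraOuterMeasure_le hA subset_rfl) (ultraboxMass_le_ultraOuterMeasure A)

theorem ultrabox_univ (M : I → MetricStructure L) :
    ultrabox D (fun i => (univ : Set (M i).carrier)) = univ :=
  eq_univ_of_forall fun x => by
    obtain ⟨a, rfl⟩ := x.exists_rep
    exact mk_mem_ultrabox.2 (Eventually.of_forall fun _ => mem_univ _)

theorem ultraMeasure_univ : ultraMeasure D M univ = ultraboxMass D M fun _ => univ := by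
  rw [← ultrabox_univ, ultraMeasure_ultrabox fun _ => MeasurableSet.univ]

/-! ### Balls of the ultraproduct -/

theorem mk_mem_preimage_ball {M : I → MetricStructure L} {a b : ∀ i, (M i).carrier} {r : ℝ} :
    SetUltraproduct.mk D b ∈ toUltraproduct D M ⁻¹' Metric.ball (UltraproductCarrier.mk D a :
      (metricUltraproduct D M).carrier) r ↔ (ulim D fun i => dist (b i) (a i)) < r := Iff.rfl

/-- A strict inequality for a limit does not correspond to strict inequalities at the indices, so
the ball is exhausted by ultraboxes of balls of smaller radius. -/
theorem measurableSet_preimage_ball {M : I → MetricStructure L}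
    (x : (metricUltraproduct D M).carrier) (r : ℝ) :
    MeasurableSet[ultraboxSigma D M] (toUltraproduct D M ⁻¹' Metric.ball x r) := by
  obtain ⟨a, rfl⟩ := UltraproductCarrier.exists_rep x
  have : toUltraproduct D M ⁻¹' Metric.ball (UltraproductCarrier.mk D a :
      (metricUltraproduct D M).carrier) r =
      ⋃ n : ℕ, ultrabox D fun i => Metric.ball (a i) (r - 1 / (n + 1)) := by
    ext y
    obtain ⟨b, rfl⟩ := y.exists_rep
    rw [mk_mem_preimage_ball, mem_iUnion]
    constructor
    · intro h
      obtain ⟨n, hn⟩ := exists_nat_one_div_lt (sub_pos.2 h)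
      refine ⟨n, mk_mem_ultrabox.2 ?_⟩
      exact (tendsto_dist D M b a).eventually_lt_const (by linarith)
    · rintro ⟨n, hn⟩
      have hpos : (0 : ℝ) < 1 / (n + 1) := Nat.one_div_pos_of_nat
      refine lt_of_le_of_lt (le_of_tendsto (tendsto_dist D M b a)
        ((mk_mem_ultrabox.1 hn).mono fun i hi => (Metric.mem_ball.1 hi).le)) ?_
      linarith
  rw [this]
  exact MeasurableSet.iUnion fun n => measurableSet_ultrabox fun i => Metric.isOpen_ball.measurableSet

theorem measurableSet_ball_ballSigma {X : Type*} [PseudoMetricSpace X] (x : X) (r : ℝ) :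
    MeasurableSet[ballSigma X] (Metric.ball x r) :=
  MeasurableSpace.measurableSet_generateFrom ⟨x, r, rfl⟩

theorem measurable_toUltraproduct_ballSigma (M : I → MetricStructure L) :
    Measurable[ultraboxSigma D M, ballSigma (metricUltraproduct D M).carrier]
      (toUltraproduct D M) := by
  refine @measurable_generateFrom _ _ (ultraboxSigma D M) _ _ ?_
  rintro _ ⟨x, r, rfl⟩
  exact measurableSet_preimage_ball x r

theorem ballSigma_le_borel (X : Type*) [PseudoMetricSpace X] [MeasurableSpace X] [BorelSpace X] :
    ballSigma X ≤ ‹MeasurableSpace X› :=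
  MeasurableSpace.generateFrom_le (by
    rintro _ ⟨x, r, rfl⟩
    exact Metric.isOpen_ball.measurableSet)

end Ultraboxes

/-! ### Integrals of ultralimits -/

/-- The step function with steps of height `ε` at `ε, 2ε, …, Nε`. -/
def stepSum (ε : ℝ) (N : ℕ) (x : ℝ) : ℝ :=
  ∑ k ∈ Finset.range N, if (k + 1) * ε < x then ε else 0

/-- The second bound carries the induction: when the newest step is active, the earlier ones add up
to at most `N * ε`. -/
theorem stepSum_le {ε x : ℝ} (hε : 0 < ε) (hx : 0 ≤ x) (N : ℕ) :
    stepSum ε N x ≤ x ∧ stepSum ε N x ≤ N * ε := by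
  induction N with
  | zero => simpa [stepSum] using hx
  | succ N ih =>
    simp only [stepSum, Finset.sum_range_succ] at ih ⊢
    push_cast
    split_ifs with h
    · constructor <;> linarith
    · constructor <;> linarith

/-- The truncation makes induction on `N` possible, and it disappears once `(N + 1) * ε` exceeds the
range of the function. -/
theorem le_stepSum (ε x : ℝ) (N : ℕ) :
    min x ((N + 1) * ε) ≤ ε + stepSum ε N x := by
  induction N with
  | zero => simp [stepSum]
  | succ N ih =>
    simp only [stepSum, Finset.sum_range_succ] at ih ⊢
    push_cast
    split_ifs with h
    · rw [min_eq_right h.le] at ih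
      exact (min_le_right _ _).trans (by linarith)
    · rw [min_eq_left (not_lt.1 h)] at ih
      exact (min_le_left _ _).trans (by linarith)

theorem integral_stepSum {X : Type*} [MeasurableSpace X] (μ : Measure X) [IsFiniteMeasure μ]
    {f : X → ℝ} (hf : Measurable f) (ε : ℝ) (N : ℕ) :
    Integrable (fun x => stepSum ε N (f x)) μ ∧
      ∫ x, stepSum ε N (f x) ∂μ =
        ∑ k ∈ Finset.range N, μ.real {x | (k + 1) * ε < f x} * ε := by
  have hm : ∀ k : ℕ, MeasurableSet {x | (k + 1) * ε < f x} := fun k =>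
    measurableSet_lt measurable_const hf
  have hi : ∀ k : ℕ, Integrable ({x | (k + 1) * ε < f x}.indicator fun _ => ε) μ := fun k =>
    (integrable_const ε).indicator (hm k)
  have heq : (fun x => stepSum ε N (f x)) = fun x =>
      ∑ k ∈ Finset.range N, ({x | (k + 1) * ε < f x}.indicator fun _ => ε) x := by
    funext x
    simp only [stepSum, indicator_apply, mem_ofPred_eq]
  rw [heq]
  refine ⟨integrable_finsetSum _ fun k _ => hi k, ?_⟩
  rw [integral_finsetSum _ fun k _ => hi k]
  refine Finset.sum_congr rfl fun k _ => ?_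
  rw [integral_indicator_const _ (hm k), smul_eq_mul]

section Los

variable {L : MMLanguage.{u}} {I : Type u} {D : Ultrafilter I} {M : I → MMStructure L}

theorem tendsto_measureReal (A : ∀ i, Set (M i).carrier) :
    Tendsto (fun i => (M i).measure.real (A i)) D (𝓝 (ultraboxMass D M A).toReal) :=
  (ENNReal.tendsto_toReal ((ultraboxMass_le_one _).trans_lt ENNReal.one_lt_top).ne).comp
    (tendsto_ultraboxMass D M A)

variable {ν : Measure (mmUltraproductBase D M).carrier}

theorem IsUltraproductMeasure.measure_univ (hν : IsUltraproductMeasure D M ν) :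
    ν univ = ultraboxMass D M fun _ => univ := by
  rw [hν univ MeasurableSet.univ, preimage_univ, ultraMeasure_univ]

/-- `U` itself need not be ball-measurable. Its ball-measurable open subsets form a directed family
with union `U`, because they include the small balls. On each of them `ν` is the outer measure of a
preimage contained in the ultrabox of `A`. -/
theorem IsUltraproductMeasure.measure_open_le (hν : IsUltraproductMeasure D M ν)
    (hτ : IsTauAdditive ν) {U : Set (mmUltraproductBase D M).carrier} (hU : IsOpen U)
    {A : ∀ i, Set (M i).carrier} (hA : ∀ i, MeasurableSet (A i))
    (h : ∀ a : ∀ i, (M i).carrier,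
      (UltraproductCarrier.mk D a : (mmUltraproductBase D M).carrier) ∈ U →
        ∀ᶠ i in (D : Filter I), a i ∈ A i) : ν U ≤ ultraboxMass D M A := by
  set 𝒰 : Set (Set (mmUltraproductBase D M).carrier) :=
    {V | IsOpen V ∧ V ⊆ U ∧ MeasurableSet[ballSigma (mmUltraproductBase D M).carrier] V} with h𝒰
  have hUnion : ⋃₀ 𝒰 = U := by
    refine subset_antisymm (sUnion_subset fun V hV => hV.2.1) fun x hx => ?_
    obtain ⟨r, hr, hrU⟩ := Metric.isOpen_iff.1 hU x hx
    exact mem_sUnion.2 ⟨Metric.ball x r,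
      ⟨Metric.isOpen_ball, hrU, measurableSet_ball_ballSigma x r⟩, Metric.mem_ball_self hr⟩
  have hdir : DirectedOn (· ⊆ ·) 𝒰 := fun V hV W hW =>
    ⟨V ∪ W, ⟨hV.1.union hW.1, union_subset hV.2.1 hW.2.1,
      @MeasurableSet.union _ (ballSigma _) _ _ hV.2.2 hW.2.2⟩,
      subset_union_left, subset_union_right⟩
  rw [← hUnion, hτ 𝒰 (fun V hV => hV.1) hdir]
  refine iSup₂_le fun V hV => ?_
  rw [hν V hV.2.2, ultraMeasure_apply (measurable_toUltraproduct_ballSigma _ hV.2.2)]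
  refine ultraOuterMeasure_le hA fun x hx => ?_
  obtain ⟨a, rfl⟩ := x.exists_rep
  exact mk_mem_ultrabox.2 (h a (hV.2.1 hx))

/-- If `f` exceeds `t` at `[aᵢ]`, then `g i` exceeds `t` at `a i` for almost all `i`; hence
`measure_open_le` compares the superlevel sets, and step sums transfer this to integrals up to `ε`.
-/
theorem IsUltraproductMeasure.integral_le_of_nonneg (hν : IsUltraproductMeasure D M ν)
    (hτ : IsTauAdditive ν) (hν1 : ν univ ≤ 1) {f : (mmUltraproductBase D M).carrier → ℝ}
    {g : ∀ i, (M i).carrier → ℝ} {C Λ : ℝ} (hf : Continuous f) (hg : ∀ i, Continuous (g i))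
    (hfC : ∀ x, f x ∈ Icc 0 C) (hgC : ∀ i x, g i x ∈ Icc 0 C)
    (h : ∀ a : ∀ i, (M i).carrier, Tendsto (fun i => g i (a i)) D
      (𝓝 (f (UltraproductCarrier.mk D a : (mmUltraproductBase D M).carrier))))
    (hΛ : Tendsto (fun i => ∫ x, g i x ∂(M i).measure) D (𝓝 Λ)) :
    ∫ x, f x ∂ν ≤ Λ := by
  have : IsFiniteMeasure ν := ⟨hν1.trans_lt ENNReal.one_lt_top⟩
  refine le_of_forall_pos_le_add fun ε hε => ?_
  obtain ⟨N, hN⟩ := exists_nat_ge (C / ε)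
  have hCN : C ≤ (N + 1) * ε := by
    rw [div_le_iff₀ hε] at hN
    linarith
  obtain ⟨hfi, hfe⟩ := integral_stepSum ν hf.measurable ε N
  have h1 : ∫ x, f x ∂ν ≤ ε + ∑ k ∈ Finset.range N, ν.real {x | (k + 1) * ε < f x} * ε := by
    calc ∫ x, f x ∂ν ≤ ∫ x, (ε + stepSum ε N (f x)) ∂ν := by
          refine integral_mono_of_nonneg (Eventually.of_forall fun x => (hfC x).1)
            ((integrable_const ε).add hfi) (Eventually.of_forall fun x => ?_)
          have := le_stepSum ε (f x) N
          rwa [min_eq_left ((hfC x).2.trans hCN)] at this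
      _ = ν.real univ * ε + ∑ k ∈ Finset.range N, ν.real {x | (k + 1) * ε < f x} * ε := by
          rw [integral_add (integrable_const ε) hfi, hfe, integral_const, smul_eq_mul]
      _ ≤ _ := by
          have : ν.real univ ≤ 1 :=
            ENNReal.toReal_le_of_le_ofReal zero_le_one (by simpa using hν1)
          have := mul_le_of_le_one_left hε.le this
          linarith
  have h2 : ∀ t : ℝ, ν.real {x | t < f x} ≤ (ultraboxMass D M fun i => {x | t < g i x}).toReal :=
    fun t => ENNReal.toReal_mono ((ultraboxMass_le_one _).trans_lt ENNReal.one_lt_top).ne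
      (hν.measure_open_le hτ (isOpen_lt continuous_const hf)
        (fun i => measurableSet_lt measurable_const (hg i).measurable)
        fun a ha => (h a).eventually_const_lt ha)
  have h3 : ∑ k ∈ Finset.range N,
      (ultraboxMass D M fun i => {x | (k + 1) * ε < g i x}).toReal * ε ≤ Λ := by
    refine le_of_tendsto_of_tendsto'
      (tendsto_finsetSum _ fun k _ => (tendsto_measureReal _).mul_const ε) hΛ fun i => ?_
    obtain ⟨hgi, hge⟩ := integral_stepSum (M i).measure (hg i).measurable ε N
    rw [← hge]
    refine integral_mono hgi ((M i).integrable (hg i) (C := C) fun x => ?_) fun x =>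
      (stepSum_le hε (hgC i x).1 N).1
    rw [abs_of_nonneg (hgC i x).1]
    exact (hgC i x).2
  have h4 : ∑ k ∈ Finset.range N, ν.real {x | (k + 1) * ε < f x} * ε ≤ ∑ k ∈ Finset.range N,
      (ultraboxMass D M fun i => {x | (k + 1) * ε < g i x}).toReal * ε :=
    Finset.sum_le_sum fun k _ => mul_le_mul_of_nonneg_right (h2 _) hε.le
  linarith

/-- Adding `C` reduces to nonnegative functions. The correction terms match because the total masses
converge to that of `ν`. -/
theorem IsUltraproductMeasure.integral_le (hν : IsUltraproductMeasure D M ν)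
    (hτ : IsTauAdditive ν) (hν1 : ν univ ≤ 1) {f : (mmUltraproductBase D M).carrier → ℝ}
    {g : ∀ i, (M i).carrier → ℝ} {C Λ : ℝ} (hf : Continuous f) (hg : ∀ i, Continuous (g i))
    (hfC : ∀ x, |f x| ≤ C) (hgC : ∀ i x, |g i x| ≤ C)
    (h : ∀ a : ∀ i, (M i).carrier, Tendsto (fun i => g i (a i)) D
      (𝓝 (f (UltraproductCarrier.mk D a : (mmUltraproductBase D M).carrier))))
    (hΛ : Tendsto (fun i => ∫ x, g i x ∂(M i).measure) D (𝓝 Λ)) :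
    ∫ x, f x ∂ν ≤ Λ := by
  have : IsFiniteMeasure ν := ⟨hν1.trans_lt ENNReal.one_lt_top⟩
  have hfi : Integrable f ν := Integrable.of_bound hf.measurable.aestronglyMeasurable C
    (Eventually.of_forall hfC)
  have hmem : ∀ {x : ℝ}, |x| ≤ C → x + C ∈ Icc 0 (2 * C) := fun hx => by
    have := abs_le.1 hx
    constructor <;> linarith
  have huniv : Tendsto (fun i => (M i).measure.real univ) D (𝓝 (ν.real univ)) := by
    rw [measureReal_def, hν.measure_univ]
    exact tendsto_measureReal _
  have key := hν.integral_le_of_nonneg hτ hν1 (f := fun x => f x + C) (g := fun i x => g i x + C)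
    (C := 2 * C) (Λ := Λ + ν.real univ * C) (hf.add continuous_const)
    (fun i => (hg i).add continuous_const) (fun x => hmem (hfC x)) (fun i x => hmem (hgC i x))
    (fun a => (h a).add_const C) (by
      refine (hΛ.add (huniv.mul_const C)).congr fun i => ?_
      rw [integral_add ((M i).integrable (hg i) (hgC i)) (integrable_const C), integral_const,
        smul_eq_mul])
  rw [integral_add hfi (integrable_const C), integral_const, smul_eq_mul] at key
  linarith

theorem IsUltraproductMeasure.tendsto_integral (hν : IsUltraproductMeasure D M ν)
    (hτ : IsTauAdditive ν) (hν1 : ν univ ≤ 1) {f : (mmUltraproductBase D M).carrier → ℝ}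
    {g : ∀ i, (M i).carrier → ℝ} {C : ℝ} (hf : Continuous f) (hg : ∀ i, Continuous (g i))
    (hfC : ∀ x, |f x| ≤ C) (hgC : ∀ i x, |g i x| ≤ C)
    (h : ∀ a : ∀ i, (M i).carrier, Tendsto (fun i => g i (a i)) D
      (𝓝 (f (UltraproductCarrier.mk D a : (mmUltraproductBase D M).carrier)))) :
    Tendsto (fun i => ∫ x, g i x ∂(M i).measure) D (𝓝 (∫ x, f x ∂ν)) := by
  have hC : 0 ≤ C := by
    obtain ⟨x⟩ := (mmUltraproductBase D M).nonempty
    exact (abs_nonneg _).trans (hfC x)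
  have hΛ : Tendsto (fun i => ∫ x, g i x ∂(M i).measure) D
      (𝓝 (ulim D fun i => ∫ x, g i x ∂(M i).measure)) :=
    tendsto_ulim_of_abs_le D fun i => (M i).norm_integral_le hC (hgC i)
  have h1 := hν.integral_le hτ hν1 hf hg hfC hgC h hΛ
  have h2 := hν.integral_le hτ hν1 (f := fun x => -f x) (g := fun i x => -g i x) hf.neg
    (fun i => (hg i).neg) (by simpa using hfC)
    (by simpa using hgC) (fun a => (h a).neg) (by simpa only [integral_neg] using hΛ.neg)
  simp only [integral_neg] at h2
  rwa [le_antisymm h1 (by linarith)]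

/-! ### Łoś's theorem -/

theorem Term.eval_metricUltraproduct {M : I → MetricStructure L} {n : ℕ} (t : Term L n)
    (a : Fin n → ∀ i, (M i).carrier) :
    t.eval (metricUltraproduct D M) (fun k => UltraproductCarrier.mk D (a k)) =
      UltraproductCarrier.mk D fun i => t.eval (M i) fun k => a k i := by
  induction t with
  | var k => rfl
  | const c => rfl
  | app F t ih =>
    simp only [Term.eval, ih]
    exact metricUltraproduct_fn_mk D M F _

theorem snoc_apply_apply {X : I → Type*} {n : ℕ} (a : Fin n → ∀ i, X i) (b : ∀ i, X i) (i : I) :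
    (fun k => (Fin.snoc (α := fun _ => ∀ i, X i) a b : Fin (n + 1) → ∀ i, X i) k i) =
      Fin.snoc (α := fun _ => X i) (fun k => a k i) (b i) := by
  funext k
  induction k using Fin.lastCases with
  | last => simp
  | cast k => simp

theorem comp_snoc_apply {X Y : Type*} {n : ℕ} (f : X → Y) (a : Fin n → X) (b : X) :
    (fun k => f ((Fin.snoc (α := fun _ => X) a b : Fin (n + 1) → X) k)) =
      Fin.snoc (α := fun _ => Y) (fun k => f (a k)) (f b) := by
  funext k
  induction k using Fin.lastCases with
  | last => simp
  | cast k => simp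

/-- Łoś's theorem for formulas. -/
theorem Formula.tendsto_eval (hτ : IsTauAdditive ν) (hν1 : ν univ ≤ 1)
    (hν : IsUltraproductMeasure D M ν) {n : ℕ} (φ : Formula L n)
    (a : Fin n → ∀ i, (M i).carrier) :
    Tendsto (fun i => φ.eval (M i) fun k => a k i) D
      (𝓝 (φ.eval { mmUltraproductBase D M with measure := ν, measure_univ_le := hν1 }
        fun k => UltraproductCarrier.mk D (a k))) := by
  set N : MMStructure L :=
    { mmUltraproductBase D M with measure := ν, measure_univ_le := hν1 } with hN
  induction φ with
  | one => exact tendsto_const_nhds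
  | rho s t =>
    have hs := s.eval_metricUltraproduct (D := D) (M := fun i => (M i).toMetricStructure) a
    have ht := t.eval_metricUltraproduct (D := D) (M := fun i => (M i).toMetricStructure) a
    simp only [Formula.eval]
    change Tendsto _ _ (𝓝 (dist (s.eval (mmUltraproductBase D M) _)
      (t.eval (mmUltraproductBase D M) _)))
    rw [hs, ht]
    exact tendsto_dist D _ _ _
  | rel R t =>
    have ht := fun k =>
      (t k).eval_metricUltraproduct (D := D) (M := fun i => (M i).toMetricStructure) a
    simp only [Formula.eval]
    change Tendsto _ _ (𝓝 ((mmUltraproductBase D M).rel R fun k =>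
      (t k).eval (mmUltraproductBase D M) _))
    simp only [ht]
    rw [metricUltraproduct_rel_mk]
    exact tendsto_rel D _ R _
  | smul r φ ih => exact (ih a).const_mul r
  | add φ ψ ih₁ ih₂ => exact (ih₁ a).add (ih₂ a)
  | inf φ ψ ih₁ ih₂ => exact (ih₁ a).min (ih₂ a)
  | sup φ ih =>
    have ih' : ∀ b : ∀ i, (M i).carrier, Tendsto
        (fun i => φ.eval (M i) (Fin.snoc (α := fun _ => (M i).carrier) (fun k => a k i) (b i))) D
        (𝓝 (φ.eval N (Fin.snoc (α := fun _ => N.carrier) (fun k => UltraproductCarrier.mk D (a k))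
          (UltraproductCarrier.mk D b)))) := fun b => by
      have := ih (Fin.snoc (α := fun _ => ∀ i, (M i).carrier) a b)
      simp only [snoc_apply_apply, comp_snoc_apply] at this
      exact this
    -- A near-maximizer in the ultraproduct lifts to a family, which gives the lower bound.
    -- Conversely, near-maximizers at the indices where the supremum is at least `c` define a point
    -- of the ultraproduct with too large a value; `c'` leaves room because suprema need not be
    -- attained.
    refine tendsto_order.2 ⟨fun c hc => ?_, fun c hc => ?_⟩
    · obtain ⟨x, hx⟩ := exists_lt_of_lt_ciSup hc
      obtain ⟨b, rfl⟩ := UltraproductCarrier.exists_rep x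
      filter_upwards [(ih' b).eventually_const_lt hx] with i hi
      exact hi.trans_le (le_ciSup (φ.bddAbove_range_eval (M i) _) (b i))
    · by_contra hcon
      have hcon' := Ultrafilter.eventually_not.2 hcon
      obtain ⟨c', hc', hc'c⟩ := exists_between hc
      have hex : ∀ i, ∃ b : (M i).carrier, ¬ φ.sup.eval (M i) (fun k => a k i) < c →
          c' < φ.eval (M i) (Fin.snoc (α := fun _ => (M i).carrier) (fun k => a k i) b) :=
        fun i => by
          by_cases hi : φ.sup.eval (M i) (fun k => a k i) < c
          · obtain ⟨b⟩ := (M i).nonempty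
            exact ⟨b, fun h => (h hi).elim⟩
          · obtain ⟨b, hb⟩ := exists_lt_of_lt_ciSup (hc'c.trans_le (not_lt.1 hi))
            exact ⟨b, fun _ => hb⟩
      choose b hb using hex
      have h1 := ge_of_tendsto (ih' b) (hcon'.mono fun i hi => (hb i hi).le)
      have h2 := le_ciSup (φ.bddAbove_range_eval N fun k => UltraproductCarrier.mk D (a k))
        (UltraproductCarrier.mk D b)
      exact absurd (h1.trans h2) (not_le.2 hc')
  | integral φ ih =>
    exact hν.tendsto_integral hτ hν1 (C := φ.bound)
      (f := fun x : N.carrier => φ.eval N (Fin.snoc (α := fun _ => N.carrier)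
        (fun k => UltraproductCarrier.mk D (a k)) x))
      (g := fun i x => φ.eval (M i) (Fin.snoc (α := fun _ => (M i).carrier) (fun k => a k i) x))
      (continuous_eval_snoc (φ.uniformContinuous_eval N) _)
      (fun i => continuous_eval_snoc (φ.uniformContinuous_eval (M i)) _)
      (fun x => φ.abs_eval_le N _) (fun i x => φ.abs_eval_le (M i) _) fun b => by
        have := ih (Fin.snoc (α := fun _ => ∀ i, (M i).carrier) a b)
        simp only [snoc_apply_apply, comp_snoc_apply] at this
        exact this

theorem IsUltraproduct.tendsto_value (hτ : BorelMeasuresTauAdditive.{u}) {N : MMStructure L}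
    (hN : IsUltraproduct D M N) (φ : Sentence L) :
    Tendsto (fun i => Sentence.value φ (M i)) D (𝓝 (Sentence.value φ N)) := by
  obtain ⟨ν, hν1, hν, rfl⟩ := hN
  have : IsFiniteMeasure ν := ⟨hν1.trans_lt ENNReal.one_lt_top⟩
  have h := φ.tendsto_eval (hτ _ ν) hν1 hν Fin.elim0
  have heq : ∀ {X : Type u} (f : Fin 0 → X), f = Fin.elim0 := fun _ => Subsingleton.elim _ _
  simp only [heq] at h
  exact h

end Los

/-! ### Existence of ultraproducts of uniformly tight families -/

theorem mem_closure_iff_forall_nat {X : Type*} [PseudoMetricSpace X] {P : Set X} {x : X} :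
    x ∈ closure P ↔ ∀ r : ℕ, ∃ p ∈ P, dist x p < 1 / ((r : ℝ) + 1) := by
  rw [Metric.mem_closure_iff]
  refine ⟨fun h r => h _ Nat.one_div_pos_of_nat, fun h ε hε => ?_⟩
  obtain ⟨r, hr⟩ := exists_nat_one_div_lt hε
  obtain ⟨p, hp, hlt⟩ := h r
  exact ⟨p, hp, hlt.trans hr⟩

theorem measurableSet_ballSigma_closure {X : Type*} [PseudoMetricSpace X] {P : Set X}
    (hP : P.Countable) : MeasurableSet[ballSigma X] (closure P) := by
  have : closure P = ⋂ r : ℕ, ⋃ p ∈ P, Metric.ball p (1 / ((r : ℝ) + 1)) := by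
    ext x
    simp only [mem_closure_iff_forall_nat, mem_iInter, mem_iUnion, Metric.mem_ball, exists_prop]
  rw [this]
  exact MeasurableSet.iInter fun r => MeasurableSet.biUnion hP fun p _ =>
    measurableSet_ball_ballSigma p _

/-- On the closure of a countable set, open sets are traces of sets in the `σ`-algebra generated by
the balls. -/
theorem measurableSet_ballSigma_closure_inter {X : Type*} [PseudoMetricSpace X] {P : Set X}
    (hP : P.Countable) {U : Set X} (hU : IsOpen U) :
    MeasurableSet[ballSigma X] (closure P ∩ U) := by
  have : closure P ∩ U = closure P ∩ ⋃ p ∈ P, ⋃ r : ℕ,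
      ⋃ _ : Metric.ball p (1 / ((r : ℝ) + 1)) ⊆ U, Metric.ball p (1 / ((r : ℝ) + 1)) := by
    ext x
    refine and_congr_right fun hx => ?_
    simp only [mem_iUnion, exists_prop]
    refine ⟨fun hxU => ?_, fun ⟨p, _, r, h, hxr⟩ => h hxr⟩
    obtain ⟨ε, hε, hball⟩ := Metric.isOpen_iff.1 hU x hxU
    -- With radius below `ε / 2`, a ball centred in `P` and containing `x` stays within the `ε`-ball
    -- around `x`.
    obtain ⟨r, hr⟩ := exists_nat_one_div_lt (half_pos hε)
    obtain ⟨p, hp, hlt⟩ := mem_closure_iff_forall_nat.1 hx r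
    refine ⟨p, hp, r, (fun y hy => hball ?_), hlt⟩
    rw [Metric.mem_ball] at hy ⊢
    have := dist_triangle y p x
    rw [dist_comm p x] at this
    linarith
  rw [this]
  exact (measurableSet_ballSigma_closure hP).inter (MeasurableSet.biUnion hP fun p _ =>
    MeasurableSet.iUnion fun r => MeasurableSet.iUnion fun _ => measurableSet_ball_ballSigma p _)

section Existence

variable {L : MMLanguage.{u}} {I : Type u} {D : Ultrafilter I} {M : I → MMStructure L}

/-- If the measure of the ultraproduct is concentrated on a separable set, then the ultraproduct
exists. -/
theorem exists_isUltraproduct_of_countable {P : Set (mmUltraproductBase D M).carrier}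
    (hP : P.Countable)
    (h : ultraMeasure D M (toUltraproduct D _ ⁻¹' (closure P)ᶜ) = 0) :
    ∃ N, IsUltraproduct D M N := by
  classical
  let _ : MeasurableSpace (SetUltraproduct D fun i => (M i).toMetricStructure) := ultraboxSigma D _
  set q := toUltraproduct D fun i => (M i).toMetricStructure with hq
  obtain ⟨y⟩ := (mmUltraproductBase D M).nonempty
  -- The quotient map is known to be measurable only for `ballSigma`. Sending the null set outside
  -- `closure P` to one point makes it Borel measurable without changing the push-forward on
  -- ball-measurable sets.
  set g : SetUltraproduct D (fun i => (M i).toMetricStructure) →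
    (mmUltraproductBase D M).carrier := fun x => if q x ∈ closure P then q x else y with hg
  have hqm := measurable_toUltraproduct_ballSigma (D := D) fun i => (M i).toMetricStructure
  have hgm : Measurable g := by
    refine measurable_of_isOpen fun U hU => ?_
    have : g ⁻¹' U = q ⁻¹' (closure P ∩ U) ∪ (q ⁻¹' (closure P)ᶜ ∩ {_x | y ∈ U}) := by
      ext x
      by_cases hx : q x ∈ closure P <;> simp [hg, hx]
    rw [this]
    exact (hqm (measurableSet_ballSigma_closure_inter hP hU)).union
      ((hqm (measurableSet_ballSigma_closure hP).compl).inter (MeasurableSet.const _))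
  have hae : ∀ᵐ x ∂ultraMeasure D M, q x ∈ closure P := h
  have hν : IsUltraproductMeasure D M ((ultraMeasure D M).map g) := fun B hB => by
    rw [Measure.map_apply hgm (ballSigma_le_borel _ _ hB)]
    refine measure_congr (eventuallyEq_set.2 (hae.mono fun x hx => ?_))
    simp only [mem_preimage, hg, hx, if_true]
    rfl
  have hν1 : (ultraMeasure D M).map g univ ≤ 1 := by
    rw [hν.measure_univ]
    exact ultraboxMass_le_one _
  exact ⟨_, _, hν1, hν, rfl⟩

/-- The finite nets at all scales `1 / (m + 1)` yield a countable set of ultraproduct points whose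
closure has full measure. -/
theorem exists_isUltraproduct_of_tight
    (h : ∀ ε : ℝ, 0 < ε → ε ≤ 1 → ∃ (n : ℕ) (a : Fin n → ∀ i, (M i).carrier),
      ultraboxMass D M (fun i => {y | ∀ k, ε ≤ dist y (a k i)}) ≤ ENNReal.ofReal ε) :
    ∃ N, IsUltraproduct D M N := by
  have h' : ∀ m : ℕ, ∃ (n : ℕ) (a : Fin n → ∀ i, (M i).carrier),
      ultraboxMass D M (fun i => {y | ∀ k, 1 / ((m : ℝ) + 1) ≤ dist y (a k i)}) ≤
        ENNReal.ofReal (1 / ((m : ℝ) + 1)) := fun m => h _ Nat.one_div_pos_of_nat (by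
    rw [div_le_one (by positivity)]
    linarith [(Nat.cast_nonneg m : (0 : ℝ) ≤ m)])
  choose n a ha using h'
  set P : Set (mmUltraproductBase D M).carrier :=
    ⋃ m, range fun k => UltraproductCarrier.mk D (a m k) with hP
  refine exists_isUltraproduct_of_countable (P := P)
    (countable_iUnion fun m => countable_range _) ?_
  have hsub : toUltraproduct D _ ⁻¹' (closure P)ᶜ ⊆ ⋃ r : ℕ,
      toUltraproduct D _ ⁻¹' {x | ∀ p ∈ P, 1 / ((r : ℝ) + 1) ≤ dist x p} := by
    intro x hx
    rw [mem_preimage, mem_compl_iff, mem_closure_iff_forall_nat] at hx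
    push Not at hx
    exact mem_iUnion.2 hx
  -- Being `1 / (r + 1)` away from all of `P` forces a point into the exceptional set of every finer
  -- scale `m > r`, whose mass tends to zero. The strict `m > r` turns the bound on the limit
  -- distance into bounds at almost all indices.
  refine measure_mono_null hsub (measure_iUnion_null fun r => ?_)
  refine le_antisymm (ge_of_tendsto (x := atTop) (f := fun m : ℕ =>
    ENNReal.ofReal (1 / ((m : ℝ) + 1))) ?_ ?_) zero_le
  · simpa using ENNReal.tendsto_ofReal tendsto_one_div_add_atTop_nhds_zero_nat
  filter_upwards [eventually_gt_atTop r] with m hm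
  refine le_trans ?_ (ha m)
  have hmeas : ∀ i, MeasurableSet
      {y : (M i).carrier | ∀ k, 1 / ((m : ℝ) + 1) ≤ dist y (a m k i)} := fun i => by
    simp only [ofPred_forall]
    exact MeasurableSet.iInter fun k =>
      (isClosed_le continuous_const (continuous_id.dist continuous_const)).measurableSet
  rw [← ultraMeasure_ultrabox hmeas]
  refine measure_mono fun x hx => ?_
  obtain ⟨b, rfl⟩ := x.exists_rep
  refine mk_mem_ultrabox.2 (eventually_all.2 fun k => ?_)
  have hlt : 1 / ((m : ℝ) + 1) < 1 / ((r : ℝ) + 1) :=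
    one_div_lt_one_div_of_lt (by positivity) (by exact_mod_cast Nat.succ_lt_succ hm)
  have hle : 1 / ((r : ℝ) + 1) ≤ ulim D fun i => dist (b i) (a m k i) :=
    hx (UltraproductCarrier.mk D (a m k)) (mem_iUnion.2 ⟨m, mem_range_self k⟩)
  exact ((tendsto_dist D _ b (a m k)).eventually_const_lt (hlt.trans_le hle)).mono
    fun i hi => hi.le

/-! ### Tightness is expressible -/

/-- The formula `1 ∧ ρ(y, x₀) ∧ … ∧ ρ(y, xₙ₋₁)`, where `y` is the last variable, with the
distances restricted to the variables in a list. -/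
def distFormula (L : MMLanguage.{u}) {n : ℕ} (s : List (Fin n)) : Formula L (n + 1) :=
  s.foldr (fun k φ => .inf (.rho (.var (Fin.last n)) (.var k.castSucc)) φ) .one

theorem le_eval_distFormula (M : MMStructure L) {n : ℕ} (s : List (Fin n))
    (a : Fin n → M.carrier) (y : M.carrier) (c : ℝ) :
    c ≤ (distFormula L s).eval M (Fin.snoc (α := fun _ => M.carrier) a y) ↔
      c ≤ 1 ∧ ∀ k ∈ s, c ≤ dist y (a k) := by
  induction s with
  | nil => simp [distFormula, Formula.eval]
  | cons k s ih =>
    have : (distFormula L (k :: s)).eval M (Fin.snoc (α := fun _ => M.carrier) a y) =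
        min (dist y (a k))
          ((distFormula L s).eval M (Fin.snoc (α := fun _ => M.carrier) a y)) := by
      simp [distFormula, Formula.eval, Term.eval]
    rw [this, le_min_iff, ih, List.forall_mem_cons]
    tauto

/-- Prefixing a formula with suprema over all its free variables. -/
def Formula.supClosure : {n : ℕ} → Formula L n → Sentence L
  | 0, φ => φ
  | _ + 1, φ => φ.sup.supClosure

theorem Formula.eval_le_value_supClosure (M : MMStructure L) {n : ℕ} (φ : Formula L n)
    (a : Fin n → M.carrier) : φ.eval M a ≤ Sentence.value φ.supClosure M := by
  induction n with
  | zero => rw [Subsingleton.elim a Fin.elim0]; rfl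
  | succ n ih =>
    refine le_trans ?_ (ih φ.sup (Fin.init a))
    have := le_ciSup (φ.bddAbove_range_eval M (Fin.init a)) (a (Fin.last n))
    rwa [Fin.snoc_init_self] at this

theorem Formula.exists_lt_eval_of_lt_value (M : MMStructure L) {n : ℕ} (φ : Formula L n) {c : ℝ}
    (h : c < Sentence.value φ.supClosure M) : ∃ a, c < φ.eval M a := by
  induction n with
  | zero => exact ⟨_, h⟩
  | succ n ih =>
    obtain ⟨a, ha⟩ := ih φ.sup h
    obtain ⟨b, hb⟩ := exists_lt_of_lt_ciSup ha
    exact ⟨_, hb⟩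

/-- Finite unions of `ε`-balls form a directed open cover, so by `τ`-additivity their measures have
supremum `μ univ`. -/
theorem exists_finset_measure_univ_le {X : Type*} [PseudoMetricSpace X] [MeasurableSpace X]
    {μ : Measure X} [IsFiniteMeasure μ] (hμ : IsTauAdditive μ) {ε : ℝ} (hε : 0 < ε) :
    ∃ s : Finset X, μ univ ≤ μ (⋃ x ∈ s, Metric.ball x ε) + ENNReal.ofReal ε := by
  classical
  by_contra! hcon
  set 𝒰 : Set (Set X) := range fun s : Finset X => ⋃ x ∈ s, Metric.ball x ε with h𝒰
  have hun : ⋃₀ 𝒰 = univ := eq_univ_of_forall fun x =>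
    mem_sUnion.2 ⟨_, mem_range_self {x}, by simpa using hε⟩
  have hdir : DirectedOn (· ⊆ ·) 𝒰 := by
    rintro _ ⟨s, rfl⟩ _ ⟨t, rfl⟩
    exact ⟨_, mem_range_self (s ∪ t), biUnion_subset_biUnion_left fun x hx =>
      Finset.mem_union_left _ hx, biUnion_subset_biUnion_left fun x hx =>
      Finset.mem_union_right _ hx⟩
  have h := hμ 𝒰 (by
    rintro _ ⟨s, rfl⟩
    exact isOpen_biUnion fun x _ => Metric.isOpen_ball) hdir
  rw [hun, h𝒰, iSup_range] at h
  have h1 : (⨆ s : Finset X, μ (⋃ x ∈ s, Metric.ball x ε)) + ENNReal.ofReal ε ≤ μ univ := by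
    rw [ENNReal.iSup_add]
    exact iSup_le fun s => (hcon s).le
  rw [← h] at h1
  exact absurd h1 (not_le.2 (ENNReal.lt_add_right (measure_ne_top μ univ)
    (ENNReal.ofReal_pos.2 hε).ne'))

theorem exists_integral_distFormula_lt (N : MMStructure L) (hN : IsTauAdditive N.measure) {δ : ℝ}
    (hδ : 0 < δ) : ∃ (n : ℕ) (a : Fin n → N.carrier),
      (distFormula L (List.finRange n)).integral.eval N a < δ := by
  -- The integrand is at most `1` off the balls and at most `δ / 3` on them, so either part
  -- contributes at most `δ / 3`.
  obtain ⟨s, hs⟩ := exists_finset_measure_univ_le hN (ε := δ / 3) (by positivity)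
  set U : Set N.carrier := ⋃ x ∈ s, Metric.ball x (δ / 3) with hU
  have hUm : MeasurableSet U :=
    (isOpen_biUnion fun x _ => Metric.isOpen_ball : IsOpen U).measurableSet
  have hUc : N.measure.real Uᶜ ≤ δ / 3 := by
    refine ENNReal.toReal_le_of_le_ofReal (by positivity) ?_
    rw [measure_compl hUm (measure_ne_top _ _)]
    exact tsub_le_iff_left.2 hs
  refine ⟨s.card, fun k => s.equivFin.symm k, ?_⟩
  set φ := distFormula L (List.finRange s.card) with hφ
  set a : Fin s.card → N.carrier := fun k => s.equivFin.symm k with ha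
  have hle := fun y c => (le_eval_distFormula N (List.finRange s.card) a y c).1
  calc φ.integral.eval N a
      ≤ ∫ y, (Uᶜ.indicator (fun _ => (1 : ℝ)) y + δ / 3) ∂N.measure := by
        refine integral_mono (N.integrable (Formula.continuous_eval_snoc
          (φ.uniformContinuous_eval N) a) fun y => φ.abs_eval_le N _)
          (((integrable_const 1).indicator hUm.compl).add (integrable_const _)) fun y => ?_
        by_cases hy : y ∈ U
        · obtain ⟨x, hx, hxy⟩ := mem_iUnion₂.1 hy
          have h1 := (hle y _ le_rfl).2 (s.equivFin ⟨x, hx⟩) (List.mem_finRange _)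
          simp only [ha, Equiv.symm_apply_apply] at h1
          simp only [indicator_of_notMem (notMem_compl_iff.2 hy), zero_add]
          exact h1.trans (Metric.mem_ball.1 hxy).le
        · have h1 := (hle y _ le_rfl).1
          simp only [indicator_of_mem (mem_compl hy)]
          exact h1.trans (by linarith)
    _ = N.measure.real Uᶜ + N.measure.real univ * (δ / 3) := by
        rw [integral_add ((integrable_const 1).indicator hUm.compl) (integrable_const _),
          integral_indicator_const _ hUm.compl, integral_const, smul_eq_mul, smul_eq_mul, mul_one]
    _ ≤ δ / 3 + δ / 3 := add_le_add hUc
        (mul_le_of_le_one_left (by positivity) N.measureReal_univ_le)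
    _ < δ := by linarith

/-- Markov's inequality at level `ε`. The condition `ε ≤ 1` keeps the constant `1` in the minimum
from lowering the formula below `ε`. -/
theorem measure_le_of_integral_distFormula_le (M : MMStructure L) {n : ℕ} (a : Fin n → M.carrier)
    {ε : ℝ} (hε : 0 < ε) (hε1 : ε ≤ 1)
    (h : (distFormula L (List.finRange n)).integral.eval M a ≤ ε * ε) :
    M.measure {y | ∀ k, ε ≤ dist y (a k)} ≤ ENNReal.ofReal ε := by
  set φ := distFormula L (List.finRange n) with hφ
  have hle := fun y c => le_eval_distFormula M (List.finRange n) a y c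
  have hmarkov := mul_meas_ge_le_integral_of_nonneg (μ := M.measure)
    (f := fun y => φ.eval M (Fin.snoc (α := fun _ => M.carrier) a y))
    (Eventually.of_forall fun y => (hle y 0).2 ⟨zero_le_one, fun _ _ => dist_nonneg⟩)
    (M.integrable (Formula.continuous_eval_snoc (φ.uniformContinuous_eval M) a)
      fun y => φ.abs_eval_le M _) ε
  have hreal : M.measure.real
      {y | ε ≤ φ.eval M (Fin.snoc (α := fun _ => M.carrier) a y)} ≤ ε :=
    le_of_mul_le_mul_left (hmarkov.trans h) hε
  refine (measure_mono fun y hy => ?_).trans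
    ((ENNReal.le_ofReal_iff_toReal_le (measure_ne_top _ _) hε.le).2 hreal)
  exact (hle y ε).2 ⟨hε1, fun k _ => hy k⟩

/-- If the theories of the `Mᵢ` converge to the theory of a structure, the ultraproduct exists. -/
theorem exists_isUltraproduct_of_tendsto_value (N : MMStructure L)
    (hN : IsTauAdditive N.measure)
    (h : ∀ φ : Sentence L, Tendsto (fun i => Sentence.value φ (M i)) D
      (𝓝 (Sentence.value φ N))) : ∃ N', IsUltraproduct D M N' := by
  refine exists_isUltraproduct_of_tight fun ε hε hε1 => ?_
  obtain ⟨n, a, ha⟩ := exists_integral_distFormula_lt N hN (mul_pos hε hε)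
  -- Only suprema are available as quantifiers, so the existence of a tuple with small integral is
  -- expressed by a supremum of the negated integral.
  set φ : Formula L n := .smul (-1) (distFormula L (List.finRange n)).integral with hφ
  have hval : ∀ (M' : MMStructure L) (a : Fin n → M'.carrier),
      φ.eval M' a = -(distFormula L (List.finRange n)).integral.eval M' a := fun M' a => by
    simp [hφ, Formula.eval]
  have hlt : -(ε * ε) < Sentence.value φ.supClosure N := by
    refine lt_of_lt_of_le ?_ (φ.eval_le_value_supClosure N a)
    rw [hval]
    exact neg_lt_neg ha
  have hev := (h φ.supClosure).eventually_const_lt hlt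
  have hex : ∀ i, ∃ b : Fin n → (M i).carrier, -(ε * ε) < Sentence.value φ.supClosure (M i) →
      -(ε * ε) < φ.eval (M i) b := fun i => by
    by_cases hi : -(ε * ε) < Sentence.value φ.supClosure (M i)
    · obtain ⟨b, hb⟩ := φ.exists_lt_eval_of_lt_value (M i) hi
      exact ⟨b, fun _ => hb⟩
    · obtain ⟨x⟩ := (M i).nonempty
      exact ⟨fun _ => x, fun h => (hi h).elim⟩
  choose b hb using hex
  refine ⟨n, fun k i => b i k, le_of_tendsto (tendsto_ultraboxMass D M _) ?_⟩
  filter_upwards [hev] with i hi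
  refine measure_le_of_integral_distFormula_le (M i) (b i) hε hε1 ?_
  have := hb i hi
  rw [hval] at this
  linarith

/-! ### Approximation by members of a class -/

/-- The sentence `∑ |φ - φᴺ|`, the sum being over the sentences in a list. -/
def deviation (N : MMStructure L) (s : List (Sentence L)) : Sentence L :=
  s.foldr (fun φ ψ => .add (.smul (-1) (.inf (.add φ (.smul (-Sentence.value φ N) .one))
    (.smul (-1) (.add φ (.smul (-Sentence.value φ N) .one))))) ψ) (.smul 0 .one)

theorem value_deviation (N M : MMStructure L) (s : List (Sentence L)) :
    Sentence.value (deviation N s) M =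
      (s.map fun φ => |Sentence.value φ M - Sentence.value φ N|).sum := by
  induction s with
  | nil => simp [deviation, Sentence.value, Formula.eval]
  | cons φ s ih =>
    rw [List.map_cons, List.sum_cons, ← ih]
    -- Absolute values are encoded through the minimum, the only lattice connective.
    have : ∀ x : ℝ, -min x (-x) = |x| := fun x => by
      rw [abs_eq_max_neg, ← max_neg_neg, neg_neg, max_comm]
    rw [← this]
    simp [deviation, Sentence.value, Formula.eval, sub_eq_add_neg]

/-- Otherwise the statement that `ε` is at most the total deviation from `N` would hold in all of
`K`, hence in `N`, where the deviation is `0`. -/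
theorem exists_mem_forall_abs_sub_lt {K : Set (MMStructure L)} {N : MMStructure L}
    (hN : ∀ σ : ClosedStatement L, (∀ M ∈ K, σ.Holds M) → σ.Holds N)
    (s : Finset (Sentence L)) {ε : ℝ} (hε : 0 < ε) :
    ∃ M ∈ K, ∀ φ ∈ s, |Sentence.value φ M - Sentence.value φ N| < ε := by
  by_contra! hcon
  have h := hN (.le (.smul ε .one) (deviation N s.toList)) fun M hM => by
    obtain ⟨φ, hφ, hle⟩ := hcon M hM
    have h1 : Sentence.value (.smul ε .one) M = ε := by simp [Sentence.value, Formula.eval]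
    simp only [ClosedStatement.Holds, h1, value_deviation]
    refine hle.trans (List.single_le_sum ?_ _
      (List.mem_map.2 ⟨φ, Finset.mem_toList.2 hφ, rfl⟩))
    intro x hx
    obtain ⟨ψ, -, rfl⟩ := List.mem_map.1 hx
    exact abs_nonneg _
  have h1 : Sentence.value (.smul ε .one) N = ε := by simp [Sentence.value, Formula.eval]
  simp only [ClosedStatement.Holds, h1, value_deviation, sub_self, abs_zero, List.map_const',
    List.sum_replicate, smul_zero] at h
  exact absurd h (not_le.2 hε)

/-- A model of the theory of `K` is a limit of members of `K`. -/
theorem exists_family_tendsto_value {K : Set (MMStructure L)} {N : MMStructure L}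
    (hN : ∀ σ : ClosedStatement L, (∀ M ∈ K, σ.Holds M) → σ.Holds N) :
    ∃ (I : Type u) (D : Ultrafilter I) (M : I → MMStructure L), (∀ i, M i ∈ K) ∧
      ∀ φ : Sentence L, Tendsto (fun i => Sentence.value φ (M i)) D
        (𝓝 (Sentence.value φ N)) := by
  classical
  have hex : ∀ i : Finset (Sentence L) × ℕ, ∃ M ∈ K, ∀ φ ∈ i.1,
      |Sentence.value φ M - Sentence.value φ N| < 1 / ((i.2 : ℝ) + 1) := fun i =>
    exists_mem_forall_abs_sub_lt hN i.1 Nat.one_div_pos_of_nat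
  choose M hMK hM using hex
  -- Any ultrafilter finer than `atTop` on the directed index set eventually includes each sentence
  -- at each precision.
  refine ⟨Finset (Sentence L) × ℕ, Ultrafilter.of atTop, M, hMK, fun φ => ?_⟩
  refine Tendsto.mono_left ?_ (Ultrafilter.of_le atTop)
  rw [Metric.tendsto_nhds]
  intro ε hε
  obtain ⟨m, hm⟩ := exists_nat_one_div_lt hε
  filter_upwards [eventually_ge_atTop (({φ}, m) : Finset (Sentence L) × ℕ)] with i hi
  have h1 : 1 / ((i.2 : ℝ) + 1) ≤ 1 / ((m : ℝ) + 1) :=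
    one_div_le_one_div_of_le (by positivity) (by exact_mod_cast Nat.succ_le_succ hi.2)
  exact (hM i φ (hi.1 (Finset.mem_singleton_self φ))).trans_le (h1.trans hm.le)

theorem ClosedStatement.holds_of_tendsto_value {N : MMStructure L}
    (h : ∀ φ : Sentence L, Tendsto (fun i => Sentence.value φ (M i)) D
      (𝓝 (Sentence.value φ N))) {σ : ClosedStatement L} (hσ : ∀ i, σ.Holds (M i)) :
    σ.Holds N := by
  cases σ with
  | eq φ ψ => exact tendsto_nhds_unique (h φ) ((h ψ).congr fun i => (hσ i).symm)
  | le φ ψ => exact le_of_tendsto_of_tendsto' (h φ) (h ψ) hσ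

theorem ElementarilyEquivalent.holds {M N : MMStructure L} (h : ElementarilyEquivalent M N)
    {σ : ClosedStatement L} (hσ : σ.Holds M) : σ.Holds N := by
  cases σ with
  | eq φ ψ => exact (h φ).symm.trans (Eq.trans hσ (h ψ))
  | le φ ψ => exact (h φ).symm.trans_le (le_trans hσ (h ψ).le)

end Existence

end

end ContIntLogic

/-! ### The axiomatizability theorem -/

theorem proposition4p8 (hτ : ContIntLogic.BorelMeasuresTauAdditive.{u})
    (L : ContIntLogic.MMLanguage.{u}) (K : Set (ContIntLogic.MMStructure L)) :
    ContIntLogic.IsElementaryClass K ↔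
      ContIntLogic.ClosedUnderElementaryEquivalence K ∧
        ContIntLogic.ClosedUnderUltraproducts K := by
  open ContIntLogic in
  -- The axioms are all closed statements true throughout `K`.
  refine ⟨?_, fun ⟨hE, hU⟩ => ⟨{σ | ∀ M ∈ K, σ.Holds M}, subset_antisymm
    (fun M hM σ hσ => hσ M hM) fun N hN => ?_⟩⟩
  · rintro ⟨T, rfl⟩
    exact ⟨fun M N hM hMN σ hσ => hMN.holds (hM σ hσ), fun I D M hM N hN σ hσ =>
      ClosedStatement.holds_of_tendsto_value (hN.tendsto_value hτ) fun i => hM i σ hσ⟩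
  · obtain ⟨I, D, M, hMK, hlim⟩ := exists_family_tendsto_value (K := K) (N := N) hN
    obtain ⟨N', hN'⟩ := exists_isUltraproduct_of_tendsto_value N (hτ _ N.measure) hlim
    -- Sentence values in `N'` and `N` agree as limits of the same family along `D`.
    exact hE N' N (hU I D M hMK N' hN') fun φ =>
      tendsto_nhds_unique (hN'.tendsto_value hτ φ) (hlim φ)
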